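/- Let $p$ be a prime. All subgroups of profinite groups are taken to be closed and all homomorphisms continuous. A *fusion system* on a finite $p$-group $S$ is a category whose objects are the subgroups of $S$ and whose morphisms are injective group homomorphisms, which contains every homomorphism between subgroups induced by conjugation by an element of $S$, and in which every morphism is an isomorphism of the category followed by an inclusion. It is *saturated* if every isomorphism class of objects contains a fully normalized subgroup $Q$, that is: (i) (receptivity) every isomorphism $\varphi:R\to Q$ in the system extends to a morphism $N_\varphi\to N_S(Q)$ in the system, where $N_\varphi=\{x\in N_S(R)\mid \exists y\in N_S(Q)\ \forall u\in R:\ \varphi(xux^{-1})=y\varphi(u)y^{-1}\}$; and (ii) the automorphisms of $Q$ induced by conjugation by elements of $N_S(Q)$ form a Sylow $p$-subgroup of $\mathrm{Aut}_{\mathcal F}(Q)$. A *morphism* from a system $\mathcal F$ on $S$ to a system $\mathcal G$ on $T$ is a homomorphism $\alpha:S\to T$ such that for each $\varphi\in\mathrm{Hom}_{\mathcal F}(P,Q)$ there is $A(\varphi)\in\mathrm{Hom}_{\mathcal G}(\alpha(P),\alpha(Q))$ with $A(\varphi)\alpha=\alpha\varphi$ on $P$. The *inverse limit* of an inverse system $(\mathcal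 F_i)_{i\in I}$ of fusion systems on finite $p$-groups $S_i$ ($I$ a directed partially ordered set, transition maps morphisms of fusion systems) is the category on the pro-$p$ group $S=\varprojlim S_i$, with projections $f_i:S\to S_i$, whose objects are the closed subgroups of $S$, with $\mathrm{Hom}(P,Q)=\varprojlim_i\mathrm{Hom}_{\mathcal F_i}(f_i(P),f_i(Q))$, regarded as a set of continuous homomorphisms $P\to Q$. Morphisms and isomorphisms between such limits are defined as for fusion systems. A *pro-saturated fusion system* $\mathcal F$ on a pro-$p$ group $S$ is one that is isomorphic to an inverse limit of saturated fusion systems on finite $p$-groups. A subgroup $N\le S$ is *strongly $\mathcal F$-closed* if $R\le N$ implies $\varphi(R)\le N$ for all $\varphi\in\mathrm{Hom}_{\mathcal F}(R,S)$; such an $N$ is normal. If $N$ is also open, $\mathcal F/N$ is the fusion system on the finite group $S/N$ in which a homomorphism $\varphi:A\to B$ between subgroups of $S/N$ is a morphism if and only if there is $\tilde\varphi\in\mathrm{Hom}_{\mathcal F}(\tilde A,S)$, $\tilde A$ being the full preimage of $A$ in $S$, with $\varphi(uN)=\tilde\varphi(u)N$ for all $u\in\tilde A$. **Proposition.** Let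 $\mathcal F$ be a pro-saturated fusion system on a pro-$p$ group $S$. As $N$ runs through all open strongly $\mathcal F$-closed subgroups of $S$, ordered by reverse inclusion, the groups $S/N$ are finite $p$-groups, the natural maps $S/N\to S/M$ (for $N\le M$) are morphisms of fusion systems $\mathcal F/N\to\mathcal F/M$, so that the $\mathcal F/N$ form an inverse system, and the natural map $S\to\varprojlim_N S/N$ is an isomorphism $$\mathcal F\;\cong\;\varprojlim_{N}\mathcal F/N .$$ -/

import Mathlib

universe u v w

/-! ## Closed subgroups -/

namespace ClosedSubgroup

/-- The inclusion of a closed subgroup in a larger one. -/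
def inclusion {S : Type*} [Group S] [TopologicalSpace S] {P Q : ClosedSubgroup S} (h : P ≤ Q) :
    P →ₜ* Q where
  toFun x := ⟨x, h x.2⟩
  map_one' := rfl
  map_mul' _ _ := rfl
  continuous_toFun := continuous_subtype_val.subtype_mk _

/-- The whole group as a closed subgroup. -/
def whole (S : Type*) [Group S] [TopologicalSpace S] : ClosedSubgroup S :=
  ⟨⊤, isClosed_univ⟩

/-- In a discrete group every subgroup is closed. -/
def ofDiscrete {S : Type*} [Group S] [TopologicalSpace S] [DiscreteTopology S] (H : Subgroup S) :
    ClosedSubgroup S :=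
  ⟨H, isClosed_discrete _⟩

/-- The preimage of a closed subgroup under a continuous homomorphism. -/
def preimage {S T : Type*} [Group S] [TopologicalSpace S] [Group T] [TopologicalSpace T]
    (f : S →ₜ* T) (A : ClosedSubgroup T) : ClosedSubgroup S :=
  ⟨A.toSubgroup.comap f.toMonoidHom, A.isClosed'.preimage f.continuous_toFun⟩

/-- The image of a closed subgroup under a continuous homomorphism between compact Hausdorff
groups. -/
def image {S T : Type*} [Group S] [TopologicalSpace S] [CompactSpace S]
    [Group T] [TopologicalSpace T] [T2Space T] (f : S →ₜ* T) (P : ClosedSubgroup S) :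
    ClosedSubgroup T :=
  ⟨P.toSubgroup.map f.toMonoidHom, (P.isClosed'.isCompact.image f.continuous_toFun).isClosed⟩

/-- The image of an element of `P` in the image of `P`. -/
def toImage {S T : Type*} [Group S] [TopologicalSpace S] [CompactSpace S]
    [Group T] [TopologicalSpace T] [T2Space T] (f : S →ₜ* T) (P : ClosedSubgroup S) (x : P) :
    P.image f :=
  ⟨f x, x, x.2, rfl⟩

end ClosedSubgroup

/-! ## Fusion systems -/

/-- A category whose objects are the closed subgroups of a topological group `S`, whose morphisms
are continuous injective homomorphisms, which contains all homomorphisms induced by conjugation by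
an element of `S` (in particular all inclusions), and in which every morphism is an isomorphism of
the category followed by an inclusion.  When `S` is a finite `p`-group with the discrete topology
(so that all subgroups are closed and all homomorphisms are continuous) this is a fusion system
on `S`. -/
structure FusionSystem (S : Type u) [Group S] [TopologicalSpace S] where
  Hom (P Q : ClosedSubgroup S) : Set (P →ₜ* Q)
  injective : ∀ {P Q : ClosedSubgroup S} {φ : P →ₜ* Q}, φ ∈ Hom P Q → Function.Injective φ
  id_mem : ∀ P : ClosedSubgroup S, ContinuousMonoidHom.id P ∈ Hom P P
  comp_mem : ∀ {P Q R : ClosedSubgroup S} {φ : P →ₜ* Q} {ψ : Q →ₜ* R},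
    φ ∈ Hom P Q → ψ ∈ Hom Q R → ψ.comp φ ∈ Hom P R
  conj_mem : ∀ {P Q : ClosedSubgroup S} (φ : P →ₜ* Q) (s : S),
    (∀ x : P, (φ x : S) = s * x * s⁻¹) → φ ∈ Hom P Q
  factor : ∀ {P Q : ClosedSubgroup S} {φ : P →ₜ* Q}, φ ∈ Hom P Q →
    ∃ (R : ClosedSubgroup S) (hRQ : R ≤ Q), ∃ θ ∈ Hom P R, ∃ θ' ∈ Hom R P,
      (∀ x, θ' (θ x) = x) ∧ (∀ y, θ (θ' y) = y) ∧
        φ = (ClosedSubgroup.inclusion hRQ).comp θ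

namespace FusionSystem

section Basic

variable {S : Type u} [Group S] [TopologicalSpace S] (F : FusionSystem S)

theorem inclusion_mem {P Q : ClosedSubgroup S} (h : P ≤ Q) :
    ClosedSubgroup.inclusion h ∈ F.Hom P Q :=
  F.conj_mem _ 1 fun x => by
    change (x : S) = _
    simp

theorem hom_codRestrict {P Q : ClosedSubgroup S}
    {ψ : P →ₜ* ClosedSubgroup.whole S} (hψ : ψ ∈ F.Hom P (ClosedSubgroup.whole S))
    (h : ∀ x, (ψ x : S) ∈ Q) : ∃ χ ∈ F.Hom P Q, ∀ x, (χ x : S) = ψ x := by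
  obtain ⟨R, hR, θ, hθ, θ', hθ', h1, h2, rfl⟩ := F.factor hψ
  have hRQ : R ≤ Q := by
    intro r hr
    have := h (θ' ⟨r, hr⟩)
    change (θ (θ' ⟨r, hr⟩) : S) ∈ Q at this
    rwa [h2] at this
  exact ⟨_, F.comp_mem hθ (F.inclusion_mem hRQ), fun _ => rfl⟩

/-- A subgroup `Q` of `S` is strongly closed if every morphism of the system defined on a subgroup
of `Q` has its image in `Q`. -/
def IsStronglyClosed (Q : Subgroup S) : Prop :=
  ∀ (R : ClosedSubgroup S), ∀ φ ∈ F.Hom R (ClosedSubgroup.whole S),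
    R.toSubgroup ≤ Q → ∀ x : R, (φ x : S) ∈ Q

/-- `φ` is an isomorphism of the category. -/
def IsIso {P Q : ClosedSubgroup S} (φ : P →ₜ* Q) : Prop :=
  φ ∈ F.Hom P Q ∧ ∃ ψ ∈ F.Hom Q P, (∀ x, ψ (φ x) = x) ∧ ∀ y, φ (ψ y) = y

/-- The group of automorphisms of `Q` in the category. -/
def aut (Q : ClosedSubgroup S) : Subgroup (MulAut Q) where
  carrier := {α | (∃ φ ∈ F.Hom Q Q, ∀ x, φ x = α x) ∧ ∃ φ ∈ F.Hom Q Q, ∀ x, φ x = α⁻¹ x}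
  one_mem' := ⟨⟨_, F.id_mem Q, fun _ => rfl⟩, ⟨_, F.id_mem Q, fun _ => rfl⟩⟩
  mul_mem' := by
    rintro α β ⟨⟨φ, hφ, h1⟩, φ', hφ', h2⟩ ⟨⟨ψ, hψ, h3⟩, ψ', hψ', h4⟩
    refine ⟨⟨_, F.comp_mem hψ hφ, fun x => ?_⟩, _, F.comp_mem hφ' hψ', fun x => ?_⟩
    · change φ (ψ x) = α (β x)
      rw [h3, h1]
    · change ψ' (φ' x) = (α * β)⁻¹ x
      rw [h2, h4, mul_inv_rev]
      rfl
  inv_mem' := by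
    rintro α ⟨h, h'⟩
    exact ⟨h', by simpa using h⟩

/-- The subgroup of `F.aut Q` of the automorphisms induced by conjugation by elements of `S`
(which then normalize `Q`). -/
def autInner (Q : ClosedSubgroup S) : Subgroup (F.aut Q) where
  carrier := {α | ∃ s : S, ∀ x : Q, ((α : MulAut Q) x : S) = s * x * s⁻¹}
  one_mem' := ⟨1, by simp⟩
  mul_mem' := by
    rintro α β ⟨s, hs⟩ ⟨t, ht⟩
    refine ⟨s * t, fun x => ?_⟩
    change ((α : MulAut Q) ((β : MulAut Q) x) : S) = _
    rw [hs, ht]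
    group
  inv_mem' := by
    rintro α ⟨s, hs⟩
    refine ⟨s⁻¹, fun x => ?_⟩
    have h := hs ((α : MulAut Q)⁻¹ x)
    have h2 : (α : MulAut Q) ((α : MulAut Q)⁻¹ x) = x := MulAut.apply_inv_self Q _ x
    rw [h2] at h
    change (((α : MulAut Q)⁻¹ x : Q) : S) = _
    rw [h]
    group

/-- `N_φ`: the elements `x` of the normalizer of `R` for which there is `y` in the normalizer of
`Q` such that `φ (x u x⁻¹) = y φ(u) y⁻¹` for all `u` in `R`. -/
def extensionSubgroup {R Q : ClosedSubgroup S} (φ : R →ₜ* Q) : Subgroup S where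
  carrier := {x | x ∈ Subgroup.normalizer (R : Set S) ∧
    ∃ y ∈ Subgroup.normalizer (Q : Set S),
      ∀ u v : R, (v : S) = x * u * x⁻¹ → (φ v : S) = y * φ u * y⁻¹}
  one_mem' := by
    refine ⟨one_mem _, 1, one_mem _, fun u v h => ?_⟩
    have : v = u := Subtype.ext (by simpa using h)
    simp [this]
  mul_mem' := by
    rintro a b ⟨ha, y, hy, h1⟩ ⟨hb, z, hz, h2⟩
    refine ⟨mul_mem ha hb, y * z, mul_mem hy hz, fun u v h => ?_⟩
    have hm : b * u * b⁻¹ ∈ R := (Subgroup.mem_normalizer_iff.1 hb u).1 u.2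
    rw [h1 ⟨_, hm⟩ v (by rw [h]; group), h2 u ⟨_, hm⟩ rfl]
    group
  inv_mem' := by
    rintro a ⟨ha, y, hy, h1⟩
    refine ⟨inv_mem ha, y⁻¹, inv_mem hy, fun u v h => ?_⟩
    rw [h1 v u (by rw [h]; group)]
    group

end Basic

section Saturation

variable {S : Type u} [Group S] [TopologicalSpace S] [DiscreteTopology S] (F : FusionSystem S)

/-- `Q` is receptive if every isomorphism `φ : R → Q` of the system extends to a morphism
`N_φ → N_S(Q)` of the system. -/
def IsReceptive (Q : ClosedSubgroup S) : Prop :=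
  ∀ (R : ClosedSubgroup S) (φ : R →ₜ* Q), F.IsIso φ →
    ∃ ψ ∈ F.Hom (ClosedSubgroup.ofDiscrete (extensionSubgroup φ))
        (ClosedSubgroup.ofDiscrete (Subgroup.normalizer (Q : Set S))),
      ∀ (x : R) (y : ClosedSubgroup.ofDiscrete (extensionSubgroup φ)),
        (y : S) = x → (ψ y : S) = φ x

/-- `Q` is fully normalized if it is receptive and the automorphisms of `Q` induced by conjugation
in `S` form a Sylow `p`-subgroup of the automorphism group of `Q` in the system. -/
def IsFullyNormalized (p : ℕ) (Q : ClosedSubgroup S) : Prop :=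
  F.IsReceptive Q ∧ ∃ P : Sylow p (F.aut Q), (P : Subgroup (F.aut Q)) = F.autInner Q

/-- A fusion system on a finite `p`-group is saturated if every isomorphism class of the category
contains a fully normalized subgroup. -/
def IsSaturated (p : ℕ) : Prop :=
  ∀ P : ClosedSubgroup S, ∃ (Q : ClosedSubgroup S) (φ : P →ₜ* Q),
    F.IsIso φ ∧ F.IsFullyNormalized p Q

end Saturation

section Morphisms

variable {S : Type u} [Group S] [TopologicalSpace S] [CompactSpace S] [T2Space S]
  {T : Type v} [Group T] [TopologicalSpace T] [CompactSpace T] [T2Space T]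

/-- `α : S → T` is a morphism from `F` to `G`: for every morphism `φ : P → Q` of `F` there is a
(necessarily unique) morphism `A(φ) : α(P) → α(Q)` of `G` with `A(φ) ∘ α = α ∘ φ`.  By uniqueness
`A` is automatically a functor. -/
def IsMorphism (F : FusionSystem S) (G : FusionSystem T) (α : S →ₜ* T) : Prop :=
  ∀ (P Q : ClosedSubgroup S), ∀ φ ∈ F.Hom P Q, ∃ ψ ∈ G.Hom (P.image α) (Q.image α),
    ∀ x : P, ψ (P.toImage α x) = Q.toImage α (φ x)

/-- An isomorphism of (pro-)fusion systems: an isomorphism of topological groups that is a morphism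
in both directions. -/
structure Iso (F : FusionSystem S) (G : FusionSystem T) where
  toEquiv : S ≃ₜ* T
  isMorphism : F.IsMorphism G (toEquiv : S →ₜ* T)
  isMorphism_symm : G.IsMorphism F (toEquiv.symm : T →ₜ* S)

end Morphisms

end FusionSystem

/-! ## Inverse limits -/

/-- An inverse system of fusion systems on finite (discrete) groups `G i`, indexed by a partially
ordered set. -/
structure FusionInverseSystem (I : Type v) [PartialOrder I] (G : I → Type w)
    [∀ i, Group (G i)] [∀ i, TopologicalSpace (G i)] [∀ i, DiscreteTopology (G i)]
    [∀ i, Finite (G i)] where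
  sys : ∀ i, FusionSystem (G i)
  map : ∀ {i j : I}, i ≤ j → (G j →ₜ* G i)
  map_self : ∀ (i : I) (x : G i), map (le_refl i) x = x
  map_map : ∀ {i j k : I} (hij : i ≤ j) (hjk : j ≤ k) (x : G k),
    map hij (map hjk x) = map (hij.trans hjk) x
  isMorphism : ∀ {i j : I} (h : i ≤ j), (sys j).IsMorphism (sys i) (map h)

namespace FusionInverseSystem

variable {I : Type v} [PartialOrder I] {G : I → Type w}
  [∀ i, Group (G i)] [∀ i, TopologicalSpace (G i)] [∀ i, DiscreteTopology (G i)]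
  [∀ i, Finite (G i)] (D : FusionInverseSystem I G)

/-- The inverse limit of the groups, as a subgroup of their product. -/
def limitSubgroup : Subgroup (∀ i, G i) where
  carrier := {x | ∀ (i j : I) (h : i ≤ j), D.map h (x j) = x i}
  one_mem' := by intro i j h; simp
  mul_mem' := by
    intro a b ha hb i j h
    simp [ha i j h, hb i j h]
  inv_mem' := by
    intro a ha i j h
    simp [ha i j h]

/-- The inverse limit of the groups, with the topology induced from the product topology. -/
abbrev LimitGroup : Type (max v w) := D.limitSubgroup

theorem isClosed_limitSubgroup : IsClosed (D.limitSubgroup : Set (∀ i, G i)) := by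
  have : (D.limitSubgroup : Set (∀ i, G i)) =
      ⋂ (i : I) (j : I) (h : i ≤ j), {x | D.map h (x j) = x i} := by
    ext x
    simp [limitSubgroup]
  rw [this]
  refine isClosed_iInter fun i => isClosed_iInter fun j => isClosed_iInter fun h => ?_
  exact isClosed_eq ((D.map h).continuous_toFun.comp (continuous_apply j)) (continuous_apply i)

instance : CompactSpace D.LimitGroup :=
  isCompact_iff_compactSpace.1 D.isClosed_limitSubgroup.isCompact

/-- The projections of the inverse limit. -/
def proj (i : I) : D.LimitGroup →ₜ* G i where
  toFun x := (x : ∀ i, G i) i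
  map_one' := rfl
  map_mul' _ _ := rfl
  continuous_toFun := (continuous_apply i).comp continuous_subtype_val

/-- The morphisms of the inverse limit: the set `lim Hom (f_i(P), f_i(Q))`, with a compatible
family `(φ_i)` regarded as the unique continuous homomorphism `φ : P → Q` that induces every
`φ_i`, that is, `f_i ∘ φ = φ_i ∘ f_i`. -/
def limitHom (P Q : ClosedSubgroup D.LimitGroup) : Set (P →ₜ* Q) :=
  {φ | ∀ i, ∃ ψ ∈ (D.sys i).Hom (P.image (D.proj i)) (Q.image (D.proj i)),
    ∀ x : P, ψ (P.toImage (D.proj i) x) = Q.toImage (D.proj i) (φ x)}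

theorem limit_ext {x y : D.LimitGroup} (h : ∀ i, D.proj i x = D.proj i y) : x = y :=
  Subtype.ext (funext h)

theorem limitHom_injective {P Q : ClosedSubgroup D.LimitGroup} {φ : P →ₜ* Q}
    (hφ : φ ∈ D.limitHom P Q) : Function.Injective φ := by
  intro x y hxy
  refine Subtype.ext (D.limit_ext fun i => ?_)
  obtain ⟨ψ, hψ, h⟩ := hφ i
  have := (D.sys i).injective hψ (by rw [h x, h y, hxy] :
    ψ (P.toImage (D.proj i) x) = ψ (P.toImage (D.proj i) y))
  exact congrArg Subtype.val this

theorem limitHom_factor {P Q : ClosedSubgroup D.LimitGroup} {φ : P →ₜ* Q}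
    (hφ : φ ∈ D.limitHom P Q) :
    ∃ (R : ClosedSubgroup D.LimitGroup) (hRQ : R ≤ Q), ∃ θ ∈ D.limitHom P R,
      ∃ θ' ∈ D.limitHom R P, (∀ x, θ' (θ x) = x) ∧ (∀ y, θ (θ' y) = y) ∧
        φ = (ClosedSubgroup.inclusion hRQ).comp θ := by
  have hinj := D.limitHom_injective hφ
  have hcont : Continuous fun x : P => (φ x : D.LimitGroup) :=
    continuous_subtype_val.comp φ.continuous_toFun
  let ρ : P →* D.LimitGroup := (Q.toSubgroup.subtype).comp φ.toMonoidHom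
  let R : ClosedSubgroup D.LimitGroup := ⟨ρ.range, (isCompact_range hcont).isClosed⟩
  have hRQ : R ≤ Q := by
    rintro _ ⟨x, rfl⟩
    exact (φ x).2
  let θ : P →ₜ* R :=
    { toFun := fun x => ⟨φ x, x, rfl⟩
      map_one' := Subtype.ext (by simp)
      map_mul' := fun x y => Subtype.ext (by simp)
      continuous_toFun := hcont.subtype_mk _ }
  have hθb : Function.Bijective θ := by
    constructor
    · intro x y h
      exact hinj (Subtype.ext (congrArg (fun z : R => (z : D.LimitGroup)) h))
    · rintro ⟨_, x, rfl⟩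
      exact ⟨x, rfl⟩
  let e : P ≃* R := MulEquiv.ofBijective θ hθb
  have he : Continuous e.symm :=
    Continuous.continuous_symm_of_equiv_compact_to_t2 (f := e.toEquiv) θ.continuous_toFun
  let θ' : R →ₜ* P := { e.symm.toMonoidHom with continuous_toFun := he }
  have h1 : ∀ x, θ' (θ x) = x := fun x => e.symm_apply_apply x
  have h2 : ∀ y, θ (θ' y) = y := fun y => e.apply_symm_apply y
  have key : ∀ i, (∃ ψ ∈ (D.sys i).Hom (P.image (D.proj i)) (R.image (D.proj i)),
      ∀ x : P, ψ (P.toImage (D.proj i) x) = R.toImage (D.proj i) (θ x)) ∧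
      ∃ ψ ∈ (D.sys i).Hom (R.image (D.proj i)) (P.image (D.proj i)),
      ∀ x : R, ψ (R.toImage (D.proj i) x) = P.toImage (D.proj i) (θ' x) := by
    intro i
    obtain ⟨ψ, hψ, h⟩ := hφ i
    obtain ⟨A, hAQ, τ, hτ, τ', hτ', k1, k2, k3⟩ := (D.sys i).factor hψ
    have hval : ∀ x : P, (τ (P.toImage (D.proj i) x) : G i) = D.proj i (φ x) := by
      intro x
      have := h x
      rw [k3] at this
      exact congrArg Subtype.val this
    have hAR : A ≤ R.image (D.proj i) := by
      intro a ha
      obtain ⟨x, hx, hxb⟩ := (τ' ⟨a, ha⟩).2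
      have h3 : P.toImage (D.proj i) ⟨x, hx⟩ = τ' ⟨a, ha⟩ := Subtype.ext hxb
      have h4 := hval ⟨x, hx⟩
      rw [h3, k2] at h4
      exact ⟨φ ⟨x, hx⟩, ⟨⟨x, hx⟩, rfl⟩, h4.symm⟩
    have hRA : R.image (D.proj i) ≤ A := by
      rintro _ ⟨_, ⟨x, rfl⟩, rfl⟩
      have := (τ (P.toImage (D.proj i) x)).2
      rw [hval] at this
      exact this
    refine ⟨⟨_, (D.sys i).comp_mem hτ ((D.sys i).inclusion_mem hAR), fun x => ?_⟩,
      _, (D.sys i).comp_mem ((D.sys i).inclusion_mem hRA) hτ', fun y => ?_⟩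
    · exact Subtype.ext (hval x)
    · have : ClosedSubgroup.inclusion hRA (R.toImage (D.proj i) y) =
          τ (P.toImage (D.proj i) (θ' y)) := by
        refine Subtype.ext ?_
        rw [hval]
        change D.proj i (y : D.LimitGroup) = D.proj i ((θ (θ' y) : R) : D.LimitGroup)
        rw [h2]
      change τ' (ClosedSubgroup.inclusion hRA (R.toImage (D.proj i) y)) = _
      rw [this, k1]
  exact ⟨R, hRQ, θ, fun i => (key i).1, θ', fun i => (key i).2, h1, h2, rfl⟩

/-- The inverse limit of the fusion systems, on the inverse limit of the groups. -/
def limit : FusionSystem D.LimitGroup where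
  Hom := D.limitHom
  injective := D.limitHom_injective
  id_mem P i := ⟨_, (D.sys i).id_mem _, fun _ => rfl⟩
  comp_mem := by
    intro P Q R φ ψ hφ hψ i
    obtain ⟨α, hα, h1⟩ := hφ i
    obtain ⟨β, hβ, h2⟩ := hψ i
    refine ⟨_, (D.sys i).comp_mem hα hβ, fun x => ?_⟩
    change β (α _) = _
    rw [h1, h2]
    rfl
  conj_mem := by
    intro P Q φ s hs i
    have hm : ∀ y : P.image (D.proj i),
        D.proj i s * y * (D.proj i s)⁻¹ ∈ Q.image (D.proj i) := by
      rintro ⟨_, x, hx, rfl⟩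
      refine ⟨φ ⟨x, hx⟩, (φ ⟨x, hx⟩).2, ?_⟩
      change D.proj i (φ ⟨x, hx⟩) = _
      rw [hs, map_mul, map_mul, map_inv]
      rfl
    refine ⟨⟨⟨⟨fun y => ⟨_, hm y⟩, Subtype.ext (by simp)⟩,
      fun a b => Subtype.ext (by simp)⟩, continuous_of_discreteTopology⟩,
      (D.sys i).conj_mem _ (D.proj i s) fun _ => rfl, fun x => Subtype.ext ?_⟩
    change D.proj i s * D.proj i x * (D.proj i s)⁻¹ = D.proj i (φ x)
    rw [hs, map_mul, map_mul, map_inv]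
  factor := D.limitHom_factor

end FusionInverseSystem

/-! ## Pro-fusion systems -/

namespace FusionSystem

section Pro

variable {S : Type u} [Group S] [TopologicalSpace S] [CompactSpace S] [T2Space S]

/-- A pro-fusion system (for the prime `p`): `F` is isomorphic to the inverse limit of an inverse
system of fusion systems on finite `p`-groups, indexed by a directed set. -/
def IsProFusion (p : ℕ) (F : FusionSystem S) : Prop :=
  ∃ (I : Type v) (_ : PartialOrder I) (_ : IsDirectedOrder I) (G : I → Type w)
    (_ : ∀ i, Group (G i)) (_ : ∀ i, TopologicalSpace (G i)) (_ : ∀ i, DiscreteTopology (G i))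
    (_ : ∀ i, Finite (G i)) (D : FusionInverseSystem I G),
    (∀ i, IsPGroup p (G i)) ∧ Nonempty (F.Iso D.limit)

/-- A pro-saturated fusion system: `F` is isomorphic to the inverse limit of an inverse system of
saturated fusion systems on finite `p`-groups, indexed by a directed set. -/
def IsProSaturated (p : ℕ) (F : FusionSystem S) : Prop :=
  ∃ (I : Type v) (_ : PartialOrder I) (_ : IsDirectedOrder I) (G : I → Type w)
    (_ : ∀ i, Group (G i)) (_ : ∀ i, TopologicalSpace (G i)) (_ : ∀ i, DiscreteTopology (G i))
    (_ : ∀ i, Finite (G i)) (D : FusionInverseSystem I G),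
    (∀ i, IsPGroup p (G i)) ∧ (∀ i, (D.sys i).IsSaturated p) ∧ Nonempty (F.Iso D.limit)

theorem IsProSaturated.isProFusion {p : ℕ} {F : FusionSystem S}
    (h : IsProSaturated.{u, v, w} p F) : IsProFusion.{u, v, w} p F := by
  obtain ⟨I, a, b, G, c, d, e, f, D, h1, -, h2⟩ := h
  exact ⟨I, a, b, G, c, d, e, f, D, h1, h2⟩

/-- Every endomorphism in an inverse limit is surjective. -/
theorem _root_.FusionInverseSystem.limit_surjective {I : Type v} [PartialOrder I]
    [IsDirectedOrder I] {G : I → Type w}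
    [∀ i, Group (G i)] [∀ i, TopologicalSpace (G i)] [∀ i, DiscreteTopology (G i)]
    [∀ i, Finite (G i)] (D : FusionInverseSystem I G) {P : ClosedSubgroup D.LimitGroup}
    {φ : P →ₜ* P} (hφ : φ ∈ D.limit.Hom P P) : Function.Surjective φ := by
  intro y
  let X : I → Set P := fun i => {x | D.proj i (φ x) = D.proj i y}
  have hcl : ∀ i, IsClosed (X i) := fun i =>
    isClosed_eq ((D.proj i).continuous_toFun.comp
      (continuous_subtype_val.comp φ.continuous_toFun)) continuous_const
  have hne : ∀ i, (X i).Nonempty := by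
    intro i
    obtain ⟨ψ, hψ, h⟩ := hφ i
    obtain ⟨⟨_, x, hx, rfl⟩, hz⟩ := (Finite.injective_iff_surjective.1
      ((D.sys i).injective hψ)) (P.toImage (D.proj i) y)
    refine ⟨⟨x, hx⟩, ?_⟩
    have := h ⟨x, hx⟩
    exact congrArg Subtype.val (this.symm.trans hz)
  have hmono : ∀ i j : I, i ≤ j → X j ⊆ X i := by
    intro i j hij x hx
    have h1 : ∀ z : D.LimitGroup, D.map hij (D.proj j z) = D.proj i z := fun z => z.2 i j hij
    change D.proj i (φ x) = D.proj i y
    rw [← h1, ← h1]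
    exact congrArg _ hx
  rcases isEmpty_or_nonempty I with hI | hI
  · exact ⟨y, Subtype.ext (D.limit_ext fun i => (hI.false i).elim)⟩
  · obtain ⟨x, hx⟩ := IsCompact.nonempty_iInter_of_directed_nonempty_isCompact_isClosed X
      (fun i j => by
        obtain ⟨k, hik, hjk⟩ := exists_ge_ge i j
        exact ⟨k, hmono i k hik, hmono j k hjk⟩)
      hne (fun i => (hcl i).isCompact) hcl
    exact ⟨x, Subtype.ext (D.limit_ext fun i => Set.mem_iInter.1 hx i)⟩

/-- Every endomorphism in a pro-fusion system is surjective. -/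
theorem IsProFusion.surjective {p : ℕ} {F : FusionSystem S} (hF : IsProFusion.{u, v, w} p F)
    {P : ClosedSubgroup S} {φ : P →ₜ* P} (hφ : φ ∈ F.Hom P P) : Function.Surjective φ := by
  obtain ⟨I, _, _, G, _, _, _, _, D, -, ⟨e⟩⟩ := hF
  obtain ⟨ψ, hψ, h⟩ := e.isMorphism P P φ hφ
  intro y
  obtain ⟨⟨_, x, hx, rfl⟩, hz⟩ := D.limit_surjective hψ (P.toImage _ y)
  refine ⟨⟨x, hx⟩, Subtype.ext (e.toEquiv.injective ?_)⟩
  have := h ⟨x, hx⟩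
  exact congrArg Subtype.val (this.symm.trans hz)

end Pro

/-! ## Quotients by open strongly closed subgroups -/

section Quotient

variable {S : Type u} [Group S] [TopologicalSpace S]

/-- The open strongly closed subgroups of `S`. -/
structure OSC (F : FusionSystem S) extends OpenSubgroup S where
  isStronglyClosed : F.IsStronglyClosed toOpenSubgroup.toSubgroup

namespace OSC

variable {F : FusionSystem S}

theorem ext_toSubgroup {M N : F.OSC} (h : M.toSubgroup = N.toSubgroup) : M = N := by
  obtain ⟨M, hM⟩ := M
  obtain ⟨N, hN⟩ := N
  obtain rfl : M = N := OpenSubgroup.toSubgroup_injective h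
  rfl

/-- Open strongly closed subgroups are ordered by reverse inclusion, so that smaller subgroups come
later in the inverse system. -/
instance : PartialOrder F.OSC where
  le M N := N.toSubgroup ≤ M.toSubgroup
  le_refl _ := le_rfl
  le_trans _ _ _ h h' := le_trans h' h
  le_antisymm _ _ h h' := ext_toSubgroup (le_antisymm h' h)

instance : IsDirectedOrder F.OSC where
  directed M N := by
    refine ⟨⟨M.toOpenSubgroup ⊓ N.toOpenSubgroup, fun R φ hφ h x => ?_⟩, ?_, ?_⟩
    · exact ⟨M.isStronglyClosed R φ hφ (fun y hy => (h hy).1) x,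
        N.isStronglyClosed R φ hφ (fun y hy => (h hy).2) x⟩
    · exact fun x hx => hx.1
    · exact fun x hx => hx.2

variable [IsTopologicalGroup S]

/-- An open strongly closed subgroup as a closed subgroup. -/
def toClosed (N : F.OSC) : ClosedSubgroup S :=
  ⟨N.toSubgroup, N.toOpenSubgroup.isClosed⟩

instance (N : F.OSC) : N.toSubgroup.Normal where
  conj_mem := by
    intro n hn s
    let c : N.toClosed →ₜ* ClosedSubgroup.whole S :=
      { toFun := fun x => ⟨s * x * s⁻¹, trivial⟩
        map_one' := Subtype.ext (by simp)
        map_mul' := fun a b => Subtype.ext (by simp)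
        continuous_toFun := by
          refine Continuous.subtype_mk ?_ _
          exact (continuous_const.mul continuous_subtype_val).mul continuous_const }
    exact N.isStronglyClosed N.toClosed c (F.conj_mem c s fun _ => rfl) le_rfl ⟨n, hn⟩

/-- The quotient group `S / N`. -/
abbrev Quot (N : F.OSC) : Type u := S ⧸ N.toSubgroup

instance [CompactSpace S] (N : F.OSC) : Finite N.Quot :=
  finite_of_compact_of_discrete

/-- The quotient map `S → S / N`. -/
def quotientMk (N : F.OSC) : S →ₜ* N.Quot :=
  { QuotientGroup.mk' N.toSubgroup with continuous_toFun := continuous_quot_mk }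

theorem quotientMk_eq_iff (N : F.OSC) {x y : S} : N.quotientMk x = N.quotientMk y ↔ x⁻¹ * y ∈ N.toSubgroup :=
  QuotientGroup.eq

theorem quotientMk_surjective (N : F.OSC) : Function.Surjective N.quotientMk :=
  QuotientGroup.mk_surjective

/-- The natural map `S / N → S / M` for `N ≤ M`. -/
def quotMap {M N : F.OSC} (h : M ≤ N) : N.Quot →ₜ* M.Quot where
  toMonoidHom := QuotientGroup.map N.toSubgroup M.toSubgroup (MonoidHom.id S) h
  continuous_toFun := continuous_of_discreteTopology

theorem quotMap_quotientMk {M N : F.OSC} (h : M ≤ N) (x : S) : quotMap h (N.quotientMk x) = M.quotientMk x := rfl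

end OSC

variable [IsTopologicalGroup S]

/-- The homomorphisms `φ : A → B` between subgroups of `S / N` that are induced by a morphism
`ψ` of `F` from the full preimage of `A` to `S`. -/
def quotientHom (F : FusionSystem S) (N : F.OSC) (A B : ClosedSubgroup N.Quot) : Set (A →ₜ* B) :=
  {φ | ∃ ψ ∈ F.Hom (A.preimage N.quotientMk) (ClosedSubgroup.whole S),
    ∀ u : A.preimage N.quotientMk, (φ ⟨N.quotientMk u, u.2⟩ : N.Quot) = N.quotientMk (ψ u)}

theorem toClosed_le_preimage {F : FusionSystem S} (N : F.OSC) (A : ClosedSubgroup N.Quot) :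
    N.toClosed ≤ A.preimage N.quotientMk := by
  intro x hx
  change N.quotientMk x ∈ A
  have : N.quotientMk x = 1 := (QuotientGroup.eq_one_iff x).2 hx
  rw [this]
  exact one_mem A

variable [CompactSpace S] [T2Space S]

/-- A morphism of a pro-fusion system defined on a subgroup containing `N` maps `N` onto `N`. -/
theorem IsProFusion.exists_of_mem {p : ℕ} {F : FusionSystem S} (hF : IsProFusion.{u, v, w} p F)
    (N : F.OSC) {P : ClosedSubgroup S} (hNP : N.toClosed ≤ P)
    {ψ : P →ₜ* ClosedSubgroup.whole S} (hψ : ψ ∈ F.Hom P (ClosedSubgroup.whole S))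
    {n : S} (hn : n ∈ N.toSubgroup) : ∃ m : P, (m : S) ∈ N.toSubgroup ∧ (ψ m : S) = n := by
  have h1 := F.comp_mem (F.inclusion_mem hNP) hψ
  obtain ⟨χ, hχ, h⟩ := F.hom_codRestrict (Q := N.toClosed) h1
    fun x => N.isStronglyClosed N.toClosed _ h1 le_rfl x
  obtain ⟨m, hm⟩ := hF.surjective hχ ⟨n, hn⟩
  refine ⟨⟨m, hNP m.2⟩, m.2, ?_⟩
  exact (h m).symm.trans (congrArg Subtype.val hm)

theorem quotientHom_injective (F : FusionSystem S) {p : ℕ} (hF : IsProFusion.{u, v, w} p F)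
    (N : F.OSC) {A B : ClosedSubgroup N.Quot} {φ : A →ₜ* B} (hφ : φ ∈ F.quotientHom N A B) :
    Function.Injective φ := by
  obtain ⟨ψ, hψ, h⟩ := hφ
  refine (injective_iff_map_eq_one φ).2 ?_
  rintro ⟨a, ha⟩ ha1
  obtain ⟨u, rfl⟩ := N.quotientMk_surjective a
  have h1 := h ⟨u, ha⟩
  rw [ha1] at h1
  have h2 : (ψ ⟨u, ha⟩ : S) ∈ N.toSubgroup := (QuotientGroup.eq_one_iff _).1 h1.symm
  obtain ⟨m, hm, hm2⟩ := hF.exists_of_mem N (toClosed_le_preimage N A) hψ h2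
  have h3 : m = ⟨u, ha⟩ := F.injective hψ (Subtype.ext hm2)
  refine Subtype.ext ((QuotientGroup.eq_one_iff _).2 ?_)
  rw [h3] at hm
  exact hm

/-- The quotient `F / N` of a pro-fusion system by an open strongly closed subgroup. -/
def quotient (F : FusionSystem S) {p : ℕ} (hF : IsProFusion.{u, v, w} p F) (N : F.OSC) :
    FusionSystem N.Quot where
  Hom := F.quotientHom N
  injective := F.quotientHom_injective hF N
  id_mem A := ⟨_, F.inclusion_mem (P := A.preimage N.quotientMk) (Q := ClosedSubgroup.whole S)
    (fun _ _ => trivial), fun _ => rfl⟩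
  comp_mem := by
    rintro A B C φ χ ⟨ψ, hψ, h⟩ ⟨ω, hω, h'⟩
    obtain ⟨ψ', hψ', k⟩ := F.hom_codRestrict (Q := B.preimage N.quotientMk) hψ fun x => by
      change N.quotientMk (ψ x) ∈ B
      rw [← h]
      exact (φ _).2
    refine ⟨_, F.comp_mem hψ' hω, fun u => ?_⟩
    have : φ ⟨N.quotientMk u, u.2⟩ = ⟨N.quotientMk (ψ' u), (ψ' u).2⟩ := Subtype.ext ((h u).trans (congrArg N.quotientMk (k u).symm))
    change (χ (φ ⟨N.quotientMk u, u.2⟩) : N.Quot) = N.quotientMk (ω (ψ' u))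
    rw [this]
    exact h' (ψ' u)
  conj_mem := by
    intro A B φ s hs
    obtain ⟨t, rfl⟩ := N.quotientMk_surjective s
    let c : A.preimage N.quotientMk →ₜ* ClosedSubgroup.whole S :=
      { toFun := fun x => ⟨t * x * t⁻¹, trivial⟩
        map_one' := Subtype.ext (by simp)
        map_mul' := fun a b => Subtype.ext (by simp)
        continuous_toFun := by
          refine Continuous.subtype_mk ?_ _
          exact (continuous_const.mul continuous_subtype_val).mul continuous_const }
    refine ⟨c, F.conj_mem c t fun _ => rfl, fun u => ?_⟩
    rw [hs]
    rfl
  factor := by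
    rintro A B φ ⟨ψ, hψ, h⟩
    let ρ : A →* N.Quot := (B.toSubgroup.subtype).comp φ.toMonoidHom
    let R : ClosedSubgroup N.Quot := ClosedSubgroup.ofDiscrete ρ.range
    have hRB : R ≤ B := by
      rintro _ ⟨x, rfl⟩
      exact (φ x).2
    let θ : A →ₜ* R :=
      { toFun := fun x => ⟨φ x, x, rfl⟩
        map_one' := Subtype.ext (by simp)
        map_mul' := fun x y => Subtype.ext (by simp)
        continuous_toFun := continuous_of_discreteTopology }
    have hθb : Function.Bijective θ := by
      constructor
      · intro x y hxy
        exact F.quotientHom_injective hF N ⟨ψ, hψ, h⟩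
          (Subtype.ext (congrArg (fun z : R => (z : N.Quot)) hxy))
      · rintro ⟨_, x, rfl⟩
        exact ⟨x, rfl⟩
    let e : A ≃* R := MulEquiv.ofBijective θ hθb
    let θ' : R →ₜ* A := { e.symm.toMonoidHom with
      continuous_toFun := continuous_of_discreteTopology }
    have h1 : ∀ x, θ' (θ x) = x := fun x => e.symm_apply_apply x
    have h2 : ∀ y, θ (θ' y) = y := fun y => e.apply_symm_apply y
    refine ⟨R, hRB, θ, ⟨ψ, hψ, h⟩, θ', ?_, h1, h2, rfl⟩
    obtain ⟨T, hT, τ, hτ, τ', hτ', k1, k2, rfl⟩ := F.factor hψ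
    have hRT : R.preimage N.quotientMk ≤ T := by
      rintro x ⟨⟨a, ha⟩, hx⟩
      obtain ⟨u, rfl⟩ := N.quotientMk_surjective a
      have hx' : N.quotientMk (τ ⟨u, ha⟩) = N.quotientMk x := (h ⟨u, ha⟩).symm.trans hx
      have hn := N.quotientMk_eq_iff.1 hx'
      obtain ⟨m, -, hm2⟩ := hF.exists_of_mem N (toClosed_le_preimage N A) hψ hn
      have hm3 : (τ m : S) = (τ ⟨u, ha⟩ : S)⁻¹ * x := hm2
      have : x = (τ ⟨u, ha⟩ : S) * τ m := by rw [hm3]; group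
      rw [this]
      exact mul_mem (τ ⟨u, ha⟩).2 (τ m).2
    refine ⟨_, F.comp_mem (F.inclusion_mem hRT) (F.comp_mem hτ'
      (F.inclusion_mem (Q := ClosedSubgroup.whole S) fun _ _ => trivial)), fun u => ?_⟩
    let v : A.preimage N.quotientMk := τ' (ClosedSubgroup.inclusion hRT u)
    change (θ' ⟨N.quotientMk u, u.2⟩ : N.Quot) = N.quotientMk v
    have h3 : θ ⟨N.quotientMk v, v.2⟩ = ⟨N.quotientMk u, u.2⟩ := by
      refine Subtype.ext ?_
      change (φ ⟨N.quotientMk v, v.2⟩ : N.Quot) = N.quotientMk u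
      rw [h v]
      change N.quotientMk (τ (τ' (ClosedSubgroup.inclusion hRT u))) = _
      rw [k2]
      rfl
    rw [← h3, h1]

/-- The inverse system of the quotients `F / N`, with the natural maps between the groups `S / N`,
given that these maps are morphisms of fusion systems. -/
def quotientSystem (F : FusionSystem S) {p : ℕ} (hF : IsProFusion.{u, v, w} p F)
    (h : ∀ (M N : F.OSC) (hMN : M ≤ N),
      (F.quotient hF N).IsMorphism (F.quotient hF M) (OSC.quotMap hMN)) :
    FusionInverseSystem F.OSC (fun N => N.Quot) where
  sys N := F.quotient hF N
  map hMN := OSC.quotMap hMN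
  map_self N x := by
    obtain ⟨u, rfl⟩ := N.quotientMk_surjective x
    rfl
  map_map {M N K} hMN hNK x := by
    obtain ⟨u, rfl⟩ := K.quotientMk_surjective x
    rfl
  isMorphism := h _ _

end Quotient

end FusionSystem

/-!
Everything rests on one extension property: modulo an open strongly closed subgroup `N`, each
morphism of `F` on `P` extends to `PN`, so that it induces a morphism of `F / N`.  Conversely, a map
that extends modulo every `N` is a morphism of `F`, because the kernels of the projections `S → S_i`
are among the `N`; the same kernels separate points, and compactness gives `S ≅ lim S / N`.

For a saturated system on a finite `p`-group and any strongly closed `T`, extension modulo `T` is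
proved by induction on the index of `P`.  Sylow's theorem in `Aut(Q)`, for `Q` fully normalized and
conjugate to `P`, yields isomorphisms onto `Q` that extend to normalizers, which reduces the problem
to an automorphism `γ` of `Q`.  The automorphisms of `Q` that are trivial modulo `T` form a normal
subgroup containing those induced by `N_T(Q)`; by a Frattini argument, correcting `γ` by one of them
carries the automorphisms induced by `N_T(Q)` into a Sylow subgroup, and receptivity extends the
result to `Q N_T(Q)`, which is larger than `Q` unless `T ≤ Q`.

In the limit, let `N` contain the kernel of `S → S_k`.  By compactness the preimage in `S_j` of the
image of `N` in `S_k` is strongly closed for all large `j`, although the image of `N` in `S_j` need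
not be.  The extensions that exist at these finite levels are then assembled into one on `PN`.
-/

namespace FusionSystem

section HomOn

variable {S : Type u} [Group S] [TopologicalSpace S]

theorem exists_continuousMonoidHom {T : Type v} [Group T] [TopologicalSpace T]
    {P : ClosedSubgroup S} {Q : ClosedSubgroup T} {f : S → T} (hf : ContinuousOn f P)
    (hmul : ∀ x ∈ P, ∀ y ∈ P, f (x * y) = f x * f y) (hPQ : Set.MapsTo f P Q) :
    ∃ φ : P →ₜ* Q, ∀ x, (φ x : T) = f x :=
  ⟨⟨MonoidHom.mk' (fun x => ⟨f x, hPQ x.2⟩) fun x y => Subtype.ext (hmul x x.2 y y.2),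
    hf.domRestrict.subtype_mk _⟩, fun _ => rfl⟩

variable {F : FusionSystem S} {f g : S → S} {P Q T : Subgroup S}

/-- The function `f` restricts to a morphism of `F` from the closed subgroup `P` to `S`.  Morphisms
are treated as functions on the whole group, with arbitrary values outside `P`, so that restriction
and composition need no transport between subtypes. -/
def IsHomOn (F : FusionSystem S) (f : S → S) (P : Subgroup S) : Prop :=
  ∃ hP : IsClosed (P : Set S), ∃ φ ∈ F.Hom ⟨P, hP⟩ (ClosedSubgroup.whole S), ∀ x, (φ x : S) = f x

theorem isHomOn_of_mem_hom {P Q : ClosedSubgroup S} {φ : P →ₜ* Q} (hφ : φ ∈ F.Hom P Q)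
    (hf : ∀ x : P, f x = φ x) : F.IsHomOn f P.toSubgroup :=
  ⟨P.isClosed', _, F.comp_mem hφ (F.inclusion_mem (Q := .whole S) fun _ _ => trivial),
    fun x => (hf x).symm⟩

theorem exists_isHomOn {P Q : ClosedSubgroup S} {φ : P →ₜ* Q} (hφ : φ ∈ F.Hom P Q) :
    ∃ f, F.IsHomOn f P.toSubgroup ∧ ∀ x : P, f x = φ x := by
  have hf : ∀ x : P, Function.extend Subtype.val (fun x => (φ x : S)) id x = φ x :=
    Subtype.val_injective.extend_apply _ _
  exact ⟨_, isHomOn_of_mem_hom hφ hf, hf⟩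

theorem isHomOn_conj [IsTopologicalGroup S] (F : FusionSystem S) (hP : IsClosed (P : Set S))
    (s : S) : F.IsHomOn (fun x => s * x * s⁻¹) P := by
  obtain ⟨φ, hφ⟩ := exists_continuousMonoidHom (P := ⟨P, hP⟩) (Q := .whole S)
    (f := fun x => s * x * s⁻¹) (by fun_prop) (fun x _ y _ => by group) fun _ _ => trivial
  exact ⟨hP, φ, F.conj_mem φ s hφ, hφ⟩

theorem isHomOn_id (F : FusionSystem S) (hP : IsClosed (P : Set S)) : F.IsHomOn id P :=
  isHomOn_of_mem_hom (F.id_mem ⟨P, hP⟩) fun _ => rfl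

namespace IsHomOn

theorem exists_hom {P Q : ClosedSubgroup S} (hf : F.IsHomOn f P.toSubgroup)
    (hPQ : Set.MapsTo f P Q) : ∃ φ ∈ F.Hom P Q, ∀ x, (φ x : S) = f x := by
  obtain ⟨hP, φ, hφ, hφf⟩ := hf
  obtain ⟨χ, hχ, hχφ⟩ := F.hom_codRestrict (Q := Q) hφ fun x => (hφf x).symm ▸ hPQ x.2
  exact ⟨χ, hχ, fun x => (hχφ x).trans (hφf x)⟩

theorem isClosed (hf : F.IsHomOn f P) : IsClosed (P : Set S) := hf.1

theorem congr (hf : F.IsHomOn f P) (hfg : Set.EqOn f g P) : F.IsHomOn g P := by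
  obtain ⟨hP, φ, hφ, hφf⟩ := hf
  exact ⟨hP, φ, hφ, fun x => (hφf x).trans (hfg x.2)⟩

theorem map_mul (hf : F.IsHomOn f P) {x y : S} (hx : x ∈ P) (hy : y ∈ P) :
    f (x * y) = f x * f y := by
  obtain ⟨hP, φ, -, hφf⟩ := hf
  have h : (φ (⟨x, hx⟩ * ⟨y, hy⟩) : S) = φ ⟨x, hx⟩ * φ ⟨y, hy⟩ :=
    congrArg Subtype.val (_root_.map_mul φ _ _)
  rwa [hφf, hφf, hφf] at h

theorem map_one (hf : F.IsHomOn f P) : f 1 = 1 := by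
  simpa using hf.map_mul P.one_mem P.one_mem

theorem map_inv (hf : F.IsHomOn f P) {x : S} (hx : x ∈ P) : f x⁻¹ = (f x)⁻¹ :=
  eq_inv_of_mul_eq_one_left <| by
    rw [← hf.map_mul (P.inv_mem hx) hx, inv_mul_cancel, hf.map_one]

theorem continuousOn (hf : F.IsHomOn f P) : ContinuousOn f P := by
  obtain ⟨hP, φ, -, hφf⟩ := hf
  exact continuousOn_iff_continuous_domRestrict.2
    ((continuous_subtype_val.comp φ.continuous_toFun).congr hφf)

theorem injOn (hf : F.IsHomOn f P) : Set.InjOn f P := by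
  obtain ⟨hP, φ, hφ, hφf⟩ := hf
  intro x hx y hy hxy
  have h : φ ⟨x, hx⟩ = φ ⟨y, hy⟩ := Subtype.ext (by rw [hφf, hφf, hxy])
  exact congrArg Subtype.val (F.injective hφ h)

theorem mono (hf : F.IsHomOn f P) (hQ : IsClosed (Q : Set S)) (hQP : Q ≤ P) :
    F.IsHomOn f Q := by
  obtain ⟨hP, φ, hφ, hφf⟩ := hf
  exact ⟨hQ, _, F.comp_mem (F.inclusion_mem (P := ⟨Q, hQ⟩) hQP) hφ, fun x => hφf ⟨x, hQP x.2⟩⟩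

theorem comp (hg : F.IsHomOn g Q) (hf : F.IsHomOn f P) (hPQ : Set.MapsTo f P Q) :
    F.IsHomOn (g ∘ f) P := by
  obtain ⟨φ, hφ, hφf⟩ := hf.exists_hom (P := ⟨P, hf.isClosed⟩) (Q := ⟨Q, hg.isClosed⟩) hPQ
  obtain ⟨hQ, ψ, hψ, hψg⟩ := hg
  exact ⟨hf.isClosed, _, F.comp_mem hφ hψ, fun x =>
    (hψg (φ x)).trans (congrArg g (hφf x))⟩

theorem exists_bijOn (hf : F.IsHomOn f P) :
    ∃ R : Subgroup S, IsClosed (R : Set S) ∧ Set.BijOn f P R := by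
  obtain ⟨hP, φ, hφ, hφf⟩ := id hf
  obtain ⟨R, hRQ, θ, -, θ', -, -, hθθ', rfl⟩ := F.factor hφ
  refine ⟨R.toSubgroup, R.isClosed', fun x hx => ?_, hf.injOn, fun y hy => ?_⟩
  · exact hφf ⟨x, hx⟩ ▸ (θ ⟨x, hx⟩).2
  · refine ⟨θ' ⟨y, hy⟩, (θ' ⟨y, hy⟩).2, ?_⟩
    rw [← hφf]
    exact congrArg Subtype.val (hθθ' ⟨y, hy⟩)

theorem leftInvOn (hf : F.IsHomOn f P) (hPQ : Set.BijOn f P Q) (hg : Set.LeftInvOn g f P) :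
    F.IsHomOn g Q := by
  obtain ⟨hP, φ, hφ, hφf⟩ := hf
  obtain ⟨R, hRQ, θ, -, θ', hθ', -, hθθ', rfl⟩ := F.factor hφ
  have hθf : ∀ x : P, (θ x : S) = f x := hφf
  have hgR : ∀ y : R, g y = θ' y := fun y => by
    rw [← hg (θ' y).2, ← hθf, hθθ']
  have hQR : Q = R.toSubgroup := by
    refine le_antisymm (fun y hy => ?_) fun y hy => ?_
    · obtain ⟨x, hx, rfl⟩ := hPQ.surjOn hy
      exact hθf ⟨x, hx⟩ ▸ (θ ⟨x, hx⟩).2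
    · have h := hPQ.mapsTo (θ' ⟨y, hy⟩).2
      rwa [← hθf, hθθ'] at h
  exact hQR ▸ isHomOn_of_mem_hom hθ' hgR

theorem exists_inverse (hf : F.IsHomOn f P) (hPQ : Set.BijOn f P Q) :
    ∃ g, F.IsHomOn g Q ∧ Set.BijOn g Q P ∧ Set.LeftInvOn g f P ∧ Set.LeftInvOn f g Q := by
  have hinv := hPQ.invOn_invFunOn
  exact ⟨_, hf.leftInvOn hPQ hinv.1, hPQ.symm hinv.symm, hinv.1, hinv.2⟩

end IsHomOn

theorem IsStronglyClosed.map_mem (hT : F.IsStronglyClosed T) (hf : F.IsHomOn f P) (hPT : P ≤ T)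
    {x : S} (hx : x ∈ P) : f x ∈ T := by
  obtain ⟨hP, φ, hφ, hφf⟩ := hf
  exact hφf ⟨x, hx⟩ ▸ hT _ φ hφ hPT ⟨x, hx⟩

theorem isStronglyClosed_iff :
    F.IsStronglyClosed T ↔ ∀ P f, F.IsHomOn f P → P ≤ T → ∀ x ∈ P, f x ∈ T := by
  refine ⟨fun hT P f hf hPT x hx => hT.map_mem hf hPT hx, fun h R φ hφ hRT x => ?_⟩
  obtain ⟨f, hf, hfφ⟩ := exists_isHomOn hφ
  exact hfφ x ▸ h _ f hf hRT x x.2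

theorem IsStronglyClosed.normal [IsTopologicalGroup S] (hT : F.IsStronglyClosed T)
    (hTc : IsClosed (T : Set S)) : T.Normal :=
  ⟨fun _ hn s => hT.map_mem (F.isHomOn_conj hTc s) le_rfl hn⟩

theorem IsHomOn.map_congr (hf : F.IsHomOn f P) (hT : F.IsStronglyClosed T)
    (hTc : IsClosed (T : Set S)) {x y : S} (hx : x ∈ P) (hy : y ∈ P) (hxy : (x : S ⧸ T) = y) :
    (f x : S ⧸ T) = f y := by
  rw [QuotientGroup.eq] at hxy ⊢
  rw [← hf.map_inv hx, ← hf.map_mul (P.inv_mem hx) hy]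
  exact hT.map_mem (hf.mono (hf.isClosed.inter hTc) inf_le_left) inf_le_right
    ⟨P.mul_mem (P.inv_mem hx) hy, hxy⟩

end HomOn

section HomAlong

variable {S : Type u} [Group S] [TopologicalSpace S] {T : Type v} [Group T] [TopologicalSpace T]
  {U : Type w} [Group U] [TopologicalSpace U] {F : FusionSystem S} {G : FusionSystem T}
  {H : FusionSystem U} {α : S →ₜ* T} {β : T →ₜ* U} {P : Subgroup S}

/-- The map `a` on `P` is induced by a morphism `g : α(P) → T` of `G`, that is, `g ∘ α = a`.  For
`a = α ∘ f` this is the existence of the morphism `A(f)` in the definition of morphisms of fusion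
systems. -/
def IsHomAlong (G : FusionSystem T) (α : S →ₜ* T) (a : P → T) : Prop :=
  ∃ g, G.IsHomOn g (P.map α.toMonoidHom) ∧ ∀ x : P, g (α x) = a x

theorem IsHomAlong.map_mul {a : P → T} (ha : G.IsHomAlong α a) (x y : P) :
    a (x * y) = a x * a y := by
  obtain ⟨g, hg, hga⟩ := ha
  have hgxy : g (α x * α y) = g (α x) * g (α y) := hg.map_mul ⟨x, x.2, rfl⟩ ⟨y, y.2, rfl⟩
  rw [← hga, ← hga, ← hga, ← hgxy, Subgroup.coe_mul, _root_.map_mul]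

theorem IsHomAlong.continuous {a : P → T} (ha : G.IsHomAlong α a) : Continuous a := by
  obtain ⟨g, hg, hga⟩ := ha
  exact (hg.continuousOn.comp_continuous (α.continuous_toFun.comp continuous_subtype_val)
    fun x => ⟨x, x.2, rfl⟩).congr hga

theorem finite_setOf_isHomAlong [Finite T] (G : FusionSystem T) (α : S →ₜ* T) (P : Subgroup S) :
    {a : P → T | G.IsHomAlong α a}.Finite := by
  refine (Set.finite_range fun (g : T → T) (x : P) => g (α x)).subset ?_
  rintro a ⟨g, -, hga⟩
  exact ⟨g, funext hga⟩

theorem isHomAlong_map_iff {a : P.map α.toMonoidHom → U} :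
    H.IsHomAlong β a ↔ H.IsHomAlong (β.comp α) fun x : P => a ⟨α x, x, x.2, rfl⟩ := by
  have hP : P.map (β.comp α).toMonoidHom = (P.map α.toMonoidHom).map β.toMonoidHom :=
    (P.map_map _ _).symm
  refine exists_congr fun g => and_congr (by rw [hP]) ⟨fun h x => h ⟨α x, x, x.2, rfl⟩, fun h => ?_⟩
  rintro ⟨_, x, hx, rfl⟩
  exact h ⟨x, hx⟩

variable [CompactSpace S] [T2Space T]

theorem isHomAlong_iff_exists_hom {P Q : ClosedSubgroup S} {φ : P → Q} :
    G.IsHomAlong α (fun x : P.toSubgroup => α (φ x)) ↔ ∃ ψ ∈ G.Hom (P.image α) (Q.image α),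
      ∀ x : P, ψ (P.toImage α x) = Q.toImage α (φ x) := by
  constructor
  · rintro ⟨g, hg, hga⟩
    obtain ⟨ψ, hψ, hψg⟩ := hg.exists_hom (P := P.image α) (Q := Q.image α) <| by
      rintro _ ⟨x, hx, rfl⟩
      exact ⟨φ ⟨x, hx⟩, (φ ⟨x, hx⟩).2, (hga ⟨x, hx⟩).symm⟩
    exact ⟨ψ, hψ, fun x => Subtype.ext ((hψg _).trans (hga x))⟩
  · rintro ⟨ψ, hψ, hψφ⟩
    obtain ⟨g, hg, hgψ⟩ := exists_isHomOn hψ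
    exact ⟨g, hg, fun x => (hgψ (P.toImage α x)).trans (congrArg Subtype.val (hψφ x))⟩

theorem isMorphism_iff : F.IsMorphism G α ↔
    ∀ (P : Subgroup S) (f : S → S), F.IsHomOn f P → G.IsHomAlong α fun x : P => α (f x) := by
  constructor
  · rintro h P f ⟨hP, φ, hφ, hφf⟩
    simpa only [hφf] using isHomAlong_iff_exists_hom.2 (h ⟨P, hP⟩ _ φ hφ)
  · intro h P Q φ hφ
    obtain ⟨f, hf, hfφ⟩ := exists_isHomOn hφ
    exact isHomAlong_iff_exists_hom.1 (by simpa only [← hfφ] using h P.toSubgroup f hf)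

omit [CompactSpace S] [T2Space T] in
theorem IsHomAlong.comp_isMorphism [CompactSpace T] [T2Space U] {a : P → T}
    (ha : G.IsHomAlong α a) (hβ : G.IsMorphism H β) :
    H.IsHomAlong (β.comp α) fun x => β (a x) := by
  obtain ⟨g, hg, hga⟩ := ha
  simpa only [hga] using isHomAlong_map_iff.1 (isMorphism_iff.1 hβ _ g hg)

theorem IsMorphism.isStronglyClosed_ker (hα : F.IsMorphism G α) :
    F.IsStronglyClosed α.toMonoidHom.ker := by
  refine isStronglyClosed_iff.2 fun P f hf hP x hx => ?_
  obtain ⟨g, hg, hgf⟩ := isMorphism_iff.1 hα P f hf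
  have hαx : α x = 1 := hP hx
  have hgx := hgf ⟨x, hx⟩
  rw [hαx, hg.map_one] at hgx
  exact hgx.symm

end HomAlong

end FusionSystem

section Sylow

variable {G : Type*} [Group G] {p : ℕ} [Fact p.Prime] [Finite G]

theorem exists_conj_mem_sylow (P : Sylow p G) {H : Subgroup G} (hH : IsPGroup p H) :
    ∃ g, ∀ h ∈ H, g * h * g⁻¹ ∈ P := by
  obtain ⟨R, hHR⟩ := hH.exists_le_sylow
  obtain ⟨g, rfl⟩ := MulAction.exists_smul_eq G R P
  exact ⟨g, fun h hh => ⟨h, hHR hh, rfl⟩⟩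

theorem exists_mem_normal_conj_mem_sylow (P : Sylow p G) (K : Subgroup G) [hK : K.Normal] (γ : G) :
    ∃ κ ∈ K, ∀ a ∈ P, a ∈ K → κ * γ * a * (κ * γ)⁻¹ ∈ P := by
  let X := (P : Subgroup G) ⊔ K
  let H : Subgroup X := (((P : Subgroup G) ⊓ K).map (MulAut.conj γ).toMonoidHom).subgroupOf X
  have hH : IsPGroup p H :=
    ((P.isPGroup'.to_le inf_le_left).map _).comap_of_injective _ X.subtype_injective
  obtain ⟨⟨x, hx⟩, hxH⟩ := exists_conj_mem_sylow (P.subtype le_sup_left) hH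
  obtain ⟨y, hy, κ, hκ, rfl⟩ := Subgroup.mem_sup_of_normal_right.1 hx
  refine ⟨κ, hκ, fun a ha haK => ?_⟩
  have hγa : γ * a * γ⁻¹ ∈ X := Subgroup.mem_sup_right (hK.conj_mem a haK γ)
  have hmem : y * κ * (γ * a * γ⁻¹) * (y * κ)⁻¹ ∈ P := hxH ⟨_, hγa⟩ ⟨a, ⟨ha, haK⟩, rfl⟩
  have hconj : κ * γ * a * (κ * γ)⁻¹ = y⁻¹ * (y * κ * (γ * a * γ⁻¹) * (y * κ)⁻¹) * y := by group
  exact hconj ▸ mul_mem (mul_mem (inv_mem hy) hmem) hy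

end Sylow

theorem exists_mem_normalizer_of_lt {G : Type*} [Group G] {H K : Subgroup G}
    [Group.IsNilpotent K] (hHK : H < K) : ∃ x ∈ K, x ∉ H ∧ x ∈ Subgroup.normalizer (H : Set G) := by
  have hlt : H.subgroupOf K < ⊤ :=
    lt_top_iff_ne_top.2 fun h => hHK.not_ge (Subgroup.subgroupOf_eq_top.1 h)
  obtain ⟨x, hx, hxH⟩ := SetLike.exists_of_lt (Group.normalizerCondition_of_isNilpotent _ hlt)
  exact ⟨x, x.2, hxH, by rwa [← Subgroup.subgroupOf_normalizer_eq hHK.le] at hx⟩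

namespace FusionSystem

section ExtendsModulo

variable {S : Type u} [Group S] [TopologicalSpace S] {F : FusionSystem S} {P Q T : Subgroup S}
  {f g : S → S}

/-- The map `f` on `P` extends, up to elements of `T`, to a morphism of `F` defined on `PT`. -/
def ExtendsModulo (F : FusionSystem S) (T P : Subgroup S) (f : S → S) : Prop :=
  ∃ g, F.IsHomOn g (P ⊔ T) ∧ ∀ u ∈ P, (g u : S ⧸ T) = f u

theorem IsHomOn.extendsModulo (hf : F.IsHomOn f P) (hTP : T ≤ P) : F.ExtendsModulo T P f :=
  ⟨f, by rwa [sup_eq_left.2 hTP], fun _ _ => rfl⟩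

namespace ExtendsModulo

theorem congr (hf : F.ExtendsModulo T P f) (hfg : ∀ u ∈ P, (f u : S ⧸ T) = g u) :
    F.ExtendsModulo T P g := by
  obtain ⟨f', hf', hff'⟩ := hf
  exact ⟨f', hf', fun u hu => (hff' u hu).trans (hfg u hu)⟩

theorem mono (hf : F.ExtendsModulo T Q f) (hPT : IsClosed ((P ⊔ T : Subgroup S) : Set S))
    (hPQ : P ≤ Q) : F.ExtendsModulo T P f := by
  obtain ⟨f', hf', hff'⟩ := hf
  exact ⟨f', hf'.mono hPT (sup_le_sup_right hPQ T), fun u hu => hff' u (hPQ hu)⟩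

end ExtendsModulo

theorem IsHomOn.mapsTo_sup [IsTopologicalGroup S] (hf : F.IsHomOn f (P ⊔ T))
    (hT : F.IsStronglyClosed T) (hTc : IsClosed (T : Set S)) (hg : ∀ u ∈ P, (f u : S ⧸ T) = g u)
    (hPQ : Set.MapsTo g P Q) : Set.MapsTo f (P ⊔ T : Subgroup S) (Q ⊔ T : Subgroup S) := by
  have := hT.normal hTc
  intro z hz
  obtain ⟨u, hu, t, ht, rfl⟩ := Subgroup.mem_sup_of_normal_right.1 hz
  have hz : (f (u * t) : S ⧸ T) = g u := by
    rw [← hg u hu]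
    exact hf.map_congr hT hTc hz (Subgroup.mem_sup_left hu)
      (QuotientGroup.mk_mul_of_mem u ht)
  have h := QuotientGroup.eq.1 hz.symm
  simpa using mul_mem (Subgroup.mem_sup_left (hPQ hu)) (Subgroup.mem_sup_right (S := Q) h)

namespace ExtendsModulo

theorem comp [IsTopologicalGroup S] (hg : F.ExtendsModulo T Q g) (hf : F.ExtendsModulo T P f)
    (hT : F.IsStronglyClosed T) (hTc : IsClosed (T : Set S)) (hPQ : Set.MapsTo f P Q) :
    F.ExtendsModulo T P (g ∘ f) := by
  obtain ⟨f', hf', hff'⟩ := hf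
  obtain ⟨g', hg', hgg'⟩ := hg
  have hmaps : Set.MapsTo f' (P ⊔ T : Subgroup S) (Q ⊔ T : Subgroup S) :=
    hf'.mapsTo_sup hT hTc hff' hPQ
  refine ⟨g' ∘ f', hg'.comp hf' hmaps, fun u hu => ?_⟩
  exact (hg'.map_congr hT hTc (hmaps (Subgroup.mem_sup_left hu)) (Subgroup.mem_sup_left (hPQ hu))
    (hff' u hu)).trans (hgg' _ (hPQ hu))

theorem leftInvOn [DiscreteTopology S] [Finite T] (hf : F.ExtendsModulo T P f)
    (hT : F.IsStronglyClosed T) (hPQ : Set.BijOn f P Q) (hgf : Set.LeftInvOn g f P) :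
    F.ExtendsModulo T Q g := by
  obtain ⟨f', hf', hff'⟩ := hf
  have hTc : IsClosed (T : Set S) := isClosed_discrete _
  have := hT.normal hTc
  obtain ⟨R, -, hR⟩ := hf'.exists_bijOn
  obtain ⟨g', hg', -, hg'f', -⟩ := hf'.exists_inverse hR
  have hTR : T ≤ R := fun t ht => by
    have hf'T : F.IsHomOn f' T := hf'.mono hTc le_sup_right
    have hTT : Set.MapsTo f' T T := fun t ht => hT.map_mem hf'T le_rfl ht
    have hTbij := ((T : Set S).toFinite.injOn_iff_bijOn_of_mapsTo hTT).1 hf'T.injOn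
    obtain ⟨s, hs, rfl⟩ := hTbij.surjOn ht
    exact hR.mapsTo (Subgroup.mem_sup_right hs)
  have hQR : Q ≤ R := fun y hy => by
    obtain ⟨x, hx, rfl⟩ := hPQ.surjOn hy
    have hfx : (f' x)⁻¹ * f x ∈ R := hTR (QuotientGroup.eq.1 (hff' x hx))
    simpa using mul_mem (hR.mapsTo (Subgroup.mem_sup_left hx)) hfx
  refine ⟨g', hg'.mono (isClosed_discrete _) (sup_le hQR hTR), fun y hy => ?_⟩
  obtain ⟨x, hx, rfl⟩ := hPQ.surjOn hy
  have hxP : x ∈ P ⊔ T := Subgroup.mem_sup_left hx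
  rw [hg'.map_congr hT hTc (hQR hy) (hR.mapsTo hxP) (hff' x hx).symm, hg'f' hxP, hgf hx]

end ExtendsModulo

end ExtendsModulo

section Automorphisms

variable {S : Type u} [Group S] [TopologicalSpace S] {F : FusionSystem S} {P T : Subgroup S}
  {Q : ClosedSubgroup S} {f : S → S}

theorem IsHomOn.exists_aut (hf : F.IsHomOn f Q.toSubgroup) (hQ : Set.BijOn f Q Q) :
    ∃ α : F.aut Q, ∀ x : Q, (α.1 x : S) = f x := by
  obtain ⟨g, hg, hgQ, hgf, hfg⟩ := hf.exists_inverse (Q := Q.toSubgroup) hQ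
  obtain ⟨φ, hφ, hφf⟩ := hf.exists_hom hQ.mapsTo
  obtain ⟨ψ, hψ, hψg⟩ := hg.exists_hom hgQ.mapsTo
  let α : MulAut Q := MulEquiv.mk ⟨φ, ψ,
    fun x => Subtype.ext (by rw [hψg, hφf, hgf x.2]),
    fun x => Subtype.ext (by rw [hφf, hψg, hfg x.2])⟩ (_root_.map_mul φ)
  exact ⟨⟨α, ⟨φ, hφ, fun _ => rfl⟩, ψ, hψ, fun _ => rfl⟩, hφf⟩

theorem exists_isHomOn_aut (α : F.aut Q) :
    ∃ f, F.IsHomOn f Q.toSubgroup ∧ Set.BijOn f Q Q ∧ ∀ x : Q, f x = α.1 x := by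
  obtain ⟨⟨φ, hφ, hφα⟩, -⟩ := α.2
  obtain ⟨f, hf, hfφ⟩ := exists_isHomOn hφ
  have hfα : ∀ x : Q, f x = α.1 x := fun x => (hfφ x).trans (congrArg Subtype.val (hφα x))
  refine ⟨f, hf, ⟨fun x hx => ?_, hf.injOn, fun y hy => ?_⟩, hfα⟩
  · exact hfα ⟨x, hx⟩ ▸ (α.1 ⟨x, hx⟩).2
  · refine ⟨α.1⁻¹ ⟨y, hy⟩, (α.1⁻¹ ⟨y, hy⟩).2, ?_⟩
    rw [hfα, MulAut.apply_inv_self]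

omit [TopologicalSpace S] in
theorem bijOn_conj_of_mem_normalizer {s : S} (hs : s ∈ Subgroup.normalizer (P : Set S)) :
    Set.BijOn (fun x => s * x * s⁻¹) P P := by
  refine ⟨fun x hx => (Subgroup.mem_normalizer_iff.1 hs x).1 hx,
    fun x _ y _ hxy => mul_left_cancel (mul_right_cancel hxy), fun y hy => ?_⟩
  exact ⟨s⁻¹ * y * s, (Subgroup.mem_normalizer_iff''.1 hs y).1 hy, by group⟩

section ConjAut

variable [IsTopologicalGroup S]

theorem IsHomOn.exists_conjAut (hf : F.IsHomOn f P) (hPQ : Set.BijOn f P Q) :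
    ∃ c : Subgroup.normalizer (P : Set S) →* F.aut Q,
      ∀ x u (hu : u ∈ P), ((c x).1 ⟨f u, hPQ.mapsTo hu⟩ : S) = f (x * u * (x : S)⁻¹) := by
  obtain ⟨g, hg, hgQ, hgf, -⟩ := hf.exists_inverse (Q := Q.toSubgroup) hPQ
  have hexists : ∀ x : Subgroup.normalizer (P : Set S), ∃ α : F.aut Q,
      ∀ u (hu : u ∈ P), (α.1 ⟨f u, hPQ.mapsTo hu⟩ : S) = f (x * u * (x : S)⁻¹) := by
    intro x
    have hx := bijOn_conj_of_mem_normalizer x.2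
    obtain ⟨α, hα⟩ := (hf.comp ((F.isHomOn_conj hf.isClosed x).comp hg hgQ.mapsTo)
      (hx.comp hgQ).mapsTo).exists_aut (hPQ.comp (hx.comp hgQ))
    refine ⟨α, fun u hu => (hα _).trans ?_⟩
    simp only [Function.comp_apply, hgf hu]
  choose c hc using hexists
  refine ⟨MonoidHom.mk' c fun x y => Subtype.ext (MulEquiv.ext fun ⟨z, hz⟩ => Subtype.ext ?_), hc⟩
  obtain ⟨u, hu, rfl⟩ := hPQ.surjOn hz
  have hyu : y * u * (y : S)⁻¹ ∈ P := (Subgroup.mem_normalizer_iff.1 y.2 u).1 hu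
  have hcy : (c y).1 ⟨f u, hz⟩ = ⟨f (y * u * (y : S)⁻¹), hPQ.mapsTo hyu⟩ := Subtype.ext (hc y u hu)
  change ((c (x * y)).1 ⟨f u, hz⟩ : S) = (c x).1 ((c y).1 ⟨f u, hz⟩)
  rw [hcy, hc x _ hyu, hc _ u hu, Subgroup.coe_mul]
  congr 1
  group

/-- For an isomorphism `f : P → Q` of `F`, the homomorphism from the normalizer of `P` to the
automorphism group of `Q` that sends `x` to `f ∘ c_x ∘ f⁻¹`, where `c_x` is conjugation by `x`. -/
noncomputable def IsHomOn.conjAut (hf : F.IsHomOn f P) (hPQ : Set.BijOn f P Q) :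
    Subgroup.normalizer (P : Set S) →* F.aut Q :=
  (hf.exists_conjAut hPQ).choose

theorem IsHomOn.conjAut_apply (hf : F.IsHomOn f P) (hPQ : Set.BijOn f P Q)
    (x : Subgroup.normalizer (P : Set S)) {u : S} (hu : u ∈ P) :
    ((hf.conjAut hPQ x).1 ⟨f u, hPQ.mapsTo hu⟩ : S) = f (x * u * (x : S)⁻¹) :=
  (hf.exists_conjAut hPQ).choose_spec x u hu

end ConjAut

/-- The automorphisms of `Q` that induce the identity modulo `T`. -/
def autTrivialModulo (F : FusionSystem S) (T : Subgroup S) (Q : ClosedSubgroup S) :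
    Subgroup (F.aut Q) where
  carrier := {α | ∀ u : Q, ((α.1 u : S) : S ⧸ T) = (u : S)}
  one_mem' _ := rfl
  mul_mem' hα hβ u := (hα _).trans (hβ u)
  inv_mem' {α} hα u := by
    have h := hα (α.1⁻¹ u)
    rw [MulAut.apply_inv_self] at h
    exact h.symm

theorem IsStronglyClosed.normal_autTrivialModulo (hT : F.IsStronglyClosed T)
    (hTc : IsClosed (T : Set S)) : (F.autTrivialModulo T Q).Normal := by
  refine ⟨fun α hα β u => ?_⟩
  obtain ⟨b, hb, -, hbβ⟩ := exists_isHomOn_aut β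
  have h := hb.map_congr hT hTc (α.1 (β.1⁻¹ u)).2 (β.1⁻¹ u).2 (hα (β.1⁻¹ u))
  rwa [hbβ, hbβ, MulAut.apply_inv_self] at h

end Automorphisms

section Saturated

variable {S : Type u} [Group S] [TopologicalSpace S] [DiscreteTopology S]
  {F : FusionSystem S} {p : ℕ} {P T : Subgroup S} {Q : ClosedSubgroup S}
  {f : S → S}

theorem IsReceptive.exists_extension (hQ : F.IsReceptive Q) (hf : F.IsHomOn f P)
    (hPQ : Set.BijOn f P Q) : ∃ W g, F.IsHomOn g W ∧ P ≤ W ∧ Set.EqOn g f P ∧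
      ∀ x ∈ Subgroup.normalizer (P : Set S), ∀ y ∈ Subgroup.normalizer (Q : Set S),
        (∀ u ∈ P, f (x * u * x⁻¹) = y * f u * y⁻¹) → x ∈ W := by
  obtain ⟨φ, hφ, hφf⟩ := hf.exists_hom (P := ⟨P, hf.isClosed⟩) hPQ.mapsTo
  obtain ⟨f', hf', hf'Q, hf'f, hff'⟩ := hf.exists_inverse (Q := Q.toSubgroup) hPQ
  obtain ⟨χ, hχ, hχf'⟩ := hf'.exists_hom (Q := ⟨P, hf.isClosed⟩) hf'Q.mapsTo
  have hiso : F.IsIso φ := ⟨hφ, χ, hχ,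
    fun x => Subtype.ext (by rw [hχf', hφf, hf'f x.2]),
    fun y => Subtype.ext (by rw [hφf, hχf', hff' y.2])⟩
  obtain ⟨ψ, hψ, hψφ⟩ := hQ _ φ hiso
  obtain ⟨g, hg, hgψ⟩ := exists_isHomOn hψ
  have hmem : ∀ x ∈ Subgroup.normalizer (P : Set S), ∀ y ∈ Subgroup.normalizer (Q : Set S),
      (∀ u ∈ P, f (x * u * x⁻¹) = y * f u * y⁻¹) → x ∈ extensionSubgroup φ :=
    fun x hx y hy hxy => ⟨hx, y, hy, fun u v huv => by rw [hφf, hφf, huv, hxy u u.2]⟩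
  have hPW : P ≤ extensionSubgroup φ := fun x hx =>
    hmem x (Subgroup.le_normalizer hx) (f x) (Subgroup.le_normalizer (hPQ.mapsTo hx)) fun u hu => by
      rw [hf.map_mul (mul_mem hx hu) (inv_mem hx), hf.map_mul hx hu, hf.map_inv hx]
  refine ⟨extensionSubgroup φ, g, hg, hPW, fun x hx => ?_, hmem⟩
  rw [hgψ ⟨x, hPW hx⟩, hψφ ⟨x, hx⟩ ⟨x, hPW hx⟩ rfl, hφf]

variable [Finite S]

theorem IsReceptive.exists_extension_of_conjAut (hQ : F.IsReceptive Q) (hf : F.IsHomOn f P)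
    (hPQ : Set.BijOn f P Q) (χ : F.aut Q) : ∃ W g, F.IsHomOn g W ∧ P ≤ W ∧
      (∀ u (hu : u ∈ P), g u = χ.1 ⟨f u, hPQ.mapsTo hu⟩) ∧
      ∀ x, χ * hf.conjAut hPQ x * χ⁻¹ ∈ F.autInner Q → (x : S) ∈ W := by
  obtain ⟨c, hc, hcQ, hcχ⟩ := exists_isHomOn_aut χ
  have hcf := hc.comp hf hPQ.mapsTo
  obtain ⟨W, g, hg, hPW, hgcf, hW⟩ := hQ.exists_extension hcf (hcQ.comp hPQ)
  refine ⟨W, g, hg, hPW, fun u hu => (hgcf hu).trans (hcχ ⟨f u, _⟩), fun x hx => ?_⟩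
  obtain ⟨s, hs⟩ := hx
  have hconj : ∀ y : Q, (χ.1 ((hf.conjAut hPQ x).1 y) : S) = s * χ.1 y * s⁻¹ := fun y => by
    rw [← hs]
    simp [MulAut.mul_apply]
  have hsQ : s ∈ Subgroup.normalizer (Q : Set S) := Subgroup.mem_normalizer_fintype fun y hy => by
    have h := hconj (χ.1⁻¹ ⟨y, hy⟩)
    rw [MulAut.apply_inv_self] at h
    exact h ▸ Subtype.prop _
  refine hW x x.2 s hsQ fun u hu => ?_
  have h := hconj ⟨f u, hPQ.mapsTo hu⟩
  rwa [← hcχ, ← hcχ, hf.conjAut_apply hPQ x hu] at h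

variable [Fact p.Prime]

/- Since `N_S(P)` acts on `Q` through a `p`-group, Sylow's theorem provides an automorphism of `Q`
that moves this action into the one induced by `N_S(Q)`. -/
theorem IsFullyNormalized.exists_bijOn_normalizer (hQ : F.IsFullyNormalized p Q)
    (hS : IsPGroup p S) (hf : F.IsHomOn f P) (hPQ : Set.BijOn f P Q) :
    ∃ g, F.IsHomOn g (Subgroup.normalizer (P : Set S)) ∧ Set.BijOn g P Q := by
  obtain ⟨hrec, P₀, hP₀⟩ := hQ
  have hrange : IsPGroup p (hf.conjAut hPQ).range :=
    (hS.to_subgroup _).of_surjective _ (hf.conjAut hPQ).rangeRestrict_surjective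
  obtain ⟨χ, hχ⟩ := exists_conj_mem_sylow P₀ hrange
  obtain ⟨W, g, hg, -, hgf, hW⟩ := hrec.exists_extension_of_conjAut hf hPQ χ
  have hNW : Subgroup.normalizer (P : Set S) ≤ W := fun x hx =>
    hW ⟨x, hx⟩ (hP₀ ▸ hχ _ ⟨⟨x, hx⟩, rfl⟩)
  obtain ⟨c, -, hcQ, hcχ⟩ := exists_isHomOn_aut χ
  refine ⟨g, hg.mono (isClosed_discrete _) hNW, (hcQ.comp hPQ).congr fun u hu => ?_⟩
  rw [hgf u hu, ← hcχ]
  rfl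

theorem IsFullyNormalized.exists_extension_aut_modulo (hQ : F.IsFullyNormalized p Q)
    (hT : F.IsStronglyClosed T) (γ : F.aut Q) :
    ∃ g, F.IsHomOn g (Q.toSubgroup ⊔ T ⊓ Subgroup.normalizer (Q : Set S)) ∧
      ∀ u : Q, (g u : S ⧸ T) = (γ.1 u : S) := by
  have hTc : IsClosed (T : Set S) := isClosed_discrete _
  have hTn := hT.normal hTc
  have := hT.normal_autTrivialModulo (Q := Q) hTc
  obtain ⟨hrec, P₀, hP₀⟩ := hQ
  obtain ⟨κ, hκ, hκγ⟩ := exists_mem_normal_conj_mem_sylow P₀ (F.autTrivialModulo T Q) γ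
  have hid := F.isHomOn_id Q.isClosed'
  obtain ⟨W, g, hg, hQW, hgκγ, hW⟩ :=
    hrec.exists_extension_of_conjAut hid (Set.bijOn_id _) (κ * γ)
  have hTW : T ⊓ Subgroup.normalizer (Q : Set S) ≤ W := by
    rintro x ⟨hxT, hx⟩
    have hconj : ∀ u : Q, ((hid.conjAut (Set.bijOn_id _) ⟨x, hx⟩).1 u : S) = x * u * x⁻¹ :=
      fun u => hid.conjAut_apply (Set.bijOn_id _) ⟨x, hx⟩ u.2
    have hxP₀ : hid.conjAut (Set.bijOn_id _) ⟨x, hx⟩ ∈ (P₀ : Subgroup (F.aut Q)) :=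
      hP₀ ▸ ⟨x, hconj⟩
    refine hW ⟨x, hx⟩ (hP₀ ▸ hκγ _ hxP₀ fun u => ?_)
    rw [hconj, QuotientGroup.eq_iff_div_mem, div_eq_mul_inv, mul_assoc, mul_assoc,
      ← mul_assoc (u : S)]
    exact T.mul_mem hxT (hTn.conj_mem _ (T.inv_mem hxT) u)
  refine ⟨g, hg.mono (isClosed_discrete _) (sup_le hQW hTW), fun u => ?_⟩
  rw [hgκγ u u.2]
  exact hκ (γ.1 u)

end Saturated

end FusionSystem

theorem index_eq_of_bijOn {G : Type*} [Group G] [Finite G] {H K : Subgroup G} {f : G → G}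
    (hf : Set.BijOn f H K) : H.index = K.index := by
  have hindex := H.card_mul_index.trans K.card_mul_index.symm
  rw [show Nat.card H = Nat.card K from Nat.card_congr hf.equiv] at hindex
  exact Nat.eq_of_mul_eq_mul_left Nat.card_pos hindex

namespace FusionSystem

section SaturatedExtension

variable {S : Type u} [Group S] [TopologicalSpace S] [DiscreteTopology S] {F : FusionSystem S}
  {p : ℕ} {P T : Subgroup S} {Q : ClosedSubgroup S} {f : S → S}

theorem IsSaturated.exists_bijOn (hF : F.IsSaturated p) (hP : IsClosed (P : Set S)) :
    ∃ Q : ClosedSubgroup S, F.IsFullyNormalized p Q ∧ ∃ a, F.IsHomOn a P ∧ Set.BijOn a P Q := by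
  obtain ⟨Q, φ, ⟨hφ, ψ, -, -, hφψ⟩, hQ⟩ := hF ⟨P, hP⟩
  obtain ⟨a, ha, haφ⟩ := exists_isHomOn hφ
  refine ⟨Q, hQ, a, ha, fun x hx => ?_, ha.injOn, fun y hy => ?_⟩
  · exact haφ ⟨x, hx⟩ ▸ (φ ⟨x, hx⟩).2
  · exact ⟨ψ ⟨y, hy⟩, (ψ ⟨y, hy⟩).2, by rw [haφ, hφψ]⟩

variable [Finite S] [Fact p.Prime]

theorem IsFullyNormalized.exists_bijOn_extendsModulo (hQ : F.IsFullyNormalized p Q)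
    (hS : IsPGroup p S) (hP : P ≠ ⊤) (ih : ∀ W h, P < W → F.IsHomOn h W → F.ExtendsModulo T W h)
    (hf : F.IsHomOn f P) (hPQ : Set.BijOn f P Q) :
    ∃ g, F.IsHomOn g P ∧ Set.BijOn g P Q ∧ F.ExtendsModulo T P g := by
  have := hS.isNilpotent
  have hlt := Group.normalizerCondition_of_isNilpotent P (lt_top_iff_ne_top.2 hP)
  obtain ⟨g, hg, hgPQ⟩ := hQ.exists_bijOn_normalizer hS hf hPQ
  exact ⟨g, hg.mono hf.isClosed hlt.le, hgPQ, (ih _ g hlt hg).mono (isClosed_discrete _) hlt.le⟩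

theorem IsFullyNormalized.extendsModulo_of_bijOn (hQ : F.IsFullyNormalized p Q)
    (hS : IsPGroup p S) (hT : F.IsStronglyClosed T)
    (ih : ∀ W h, Q.toSubgroup < W → F.IsHomOn h W → F.ExtendsModulo T W h)
    (hf : F.IsHomOn f Q.toSubgroup) (hfQ : Set.BijOn f Q Q) :
    F.ExtendsModulo T Q.toSubgroup f := by
  by_cases hTQ : T ≤ Q.toSubgroup
  · exact hf.extendsModulo hTQ
  obtain ⟨α, hα⟩ := hf.exists_aut hfQ
  obtain ⟨g, hg, hgα⟩ := hQ.exists_extension_aut_modulo hT α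
  have := hT.normal (isClosed_discrete _)
  have := (hS.to_subgroup (Q.toSubgroup ⊔ T)).isNilpotent
  obtain ⟨x, hx, hxQ, hxN⟩ := exists_mem_normalizer_of_lt (left_lt_sup.2 hTQ)
  obtain ⟨q, hq, t, ht, rfl⟩ := Subgroup.mem_sup_of_normal_right.1 hx
  have htN : t ∈ Subgroup.normalizer (Q : Set S) :=
    (mul_mem_cancel_left (Subgroup.le_normalizer hq)).1 hxN
  have hlt : Q.toSubgroup < Q.toSubgroup ⊔ T ⊓ Subgroup.normalizer (Q : Set S) :=
    left_lt_sup.2 fun hle => hxQ (mul_mem hq (hle ⟨ht, htN⟩))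
  exact ((ih _ g hlt hg).mono (isClosed_discrete _) hlt.le).congr fun u hu =>
    (hgα ⟨u, hu⟩).trans (congrArg _ (hα ⟨u, hu⟩))

theorem IsSaturated.extendsModulo (hF : F.IsSaturated p) (hS : IsPGroup p S)
    (hT : F.IsStronglyClosed T) (hf : F.IsHomOn f P) : F.ExtendsModulo T P f := by
  induction hn : P.index using Nat.strong_induction_on generalizing P f with | _ n ih =>
  subst hn
  by_cases hTP : T ≤ P
  · exact hf.extendsModulo hTP
  have hTc : IsClosed (T : Set S) := isClosed_discrete _
  have ih' : ∀ {Q : Subgroup S}, P.index = Q.index → ∀ W h, Q < W → F.IsHomOn h W →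
      F.ExtendsModulo T W h := fun hPQ W h hQW hh =>
    ih _ (hPQ ▸ Subgroup.index_strictAnti hQW) hh rfl
  obtain ⟨R, -, hfR⟩ := hf.exists_bijOn
  obtain ⟨f', hf', hf'P, -, -⟩ := hf.exists_inverse hfR
  obtain ⟨Q, hQ, a, ha, haQ⟩ := hF.exists_bijOn hf.isClosed
  have hPtop : P ≠ ⊤ := fun h => hTP (h ▸ le_top)
  have hRP := index_eq_of_bijOn hfR
  -- Once `P` and `R` are moved to `Q` by extendable morphisms, `f` becomes an automorphism of `Q`.
  obtain ⟨g, hg, hgQ, hgT⟩ := hQ.exists_bijOn_extendsModulo hS hPtop (ih' rfl) ha haQ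
  obtain ⟨h, hh, hhQ, hhT⟩ := hQ.exists_bijOn_extendsModulo hS
    (fun h => hPtop (Subgroup.index_eq_one.1 (hRP.trans (Subgroup.index_eq_one.2 h))))
    (ih' hRP) (ha.comp hf' hf'P.mapsTo) (haQ.comp hf'P)
  obtain ⟨g', hg', hg'P, hg'g, -⟩ := hg.exists_inverse (Q := Q.toSubgroup) hgQ
  obtain ⟨h', -, -, hh'h, -⟩ := hh.exists_inverse (Q := Q.toSubgroup) hhQ
  have hQhfg : F.ExtendsModulo T Q.toSubgroup (h ∘ f ∘ g') :=
    hQ.extendsModulo_of_bijOn hS hT (ih' (index_eq_of_bijOn hgQ))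
      (hh.comp (hf.comp hg' hg'P.mapsTo) (hfR.mapsTo.comp hg'P.mapsTo))
      (hhQ.comp (hfR.comp hg'P))
  have hh'T : F.ExtendsModulo T Q.toSubgroup h' := hhT.leftInvOn hT hhQ hh'h
  refine ((hh'T.comp hQhfg hT hTc (hhQ.comp (hfR.comp hg'P)).mapsTo).comp hgT hT hTc
    hgQ.mapsTo).congr fun u hu => ?_
  simp only [Function.comp_apply, hg'g hu, hh'h (hfR.mapsTo hu)]

end SaturatedExtension

end FusionSystem

open CategoryTheory in
theorem exists_compatible_of_finite {I : Type u} [Preorder I] [IsDirectedOrder I] {X : I → Type v}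
    (r : ∀ ⦃i j⦄, i ≤ j → X j → X i) [InverseSystem r] {A : ∀ i, Set (X i)}
    (hfin : ∀ i, (A i).Finite) (hne : ∀ i, (A i).Nonempty)
    (hr : ∀ i j (h : i ≤ j), Set.MapsTo (r h) (A j) (A i)) :
    ∃ a : ∀ i, X i, (∀ i, a i ∈ A i) ∧ ∀ i j (h : i ≤ j), r h (a j) = a i := by
  let Φ : Iᵒᵖ ⥤ Type v :=
    { obj := fun i => A i.unop
      map := fun h => ↾((hr _ _ h.unop.le).restrict _ _ _)
      map_id := fun i => by ext x; exact InverseSystem.map_self (f := r) x.1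
      map_comp := fun h h' => by
        ext x; exact (InverseSystem.map_map (f := r) h'.unop.le h.unop.le x.1).symm }
  have (i : Iᵒᵖ) : Finite (Φ.obj i) := (hfin i.unop).to_subtype
  have (i : Iᵒᵖ) : Nonempty (Φ.obj i) := (hne i.unop).to_subtype
  obtain ⟨a, ha⟩ := nonempty_sections_of_finite_inverse_system Φ
  exact ⟨fun i => (a (.op i)).1, fun i => (a (.op i)).2,
    fun i j h => congrArg Subtype.val (ha (homOfLE h).op)⟩

namespace FusionInverseSystem

section Limit

variable {I : Type v} [PartialOrder I] {G : I → Type w} [∀ i, Group (G i)]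
  [∀ i, TopologicalSpace (G i)] [∀ i, DiscreteTopology (G i)] [∀ i, Finite (G i)]
  (D : FusionInverseSystem I G)

theorem limit_isHomOn_iff {P : Subgroup D.LimitGroup} (hP : IsClosed (P : Set D.LimitGroup))
    {f : D.LimitGroup → D.LimitGroup} : D.limit.IsHomOn f P ↔
      ∀ i, (D.sys i).IsHomAlong (D.proj i) fun x : P => D.proj i (f x) := by
  constructor
  · rintro ⟨hP, φ, hφ, hφf⟩ i
    simpa only [hφf] using FusionSystem.isHomAlong_iff_exists_hom.2 (hφ i)
  · intro h
    have hmul : ∀ x ∈ P, ∀ y ∈ P, f (x * y) = f x * f y := fun x hx y hy =>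
      D.limit_ext fun i => ((h i).map_mul ⟨x, hx⟩ ⟨y, hy⟩).trans (map_mul (D.proj i) _ _).symm
    have hcont : ContinuousOn f P := continuousOn_iff_continuous_domRestrict.2 <|
      Continuous.subtype_mk (continuous_pi fun i => (h i).continuous) fun x => (f x).2
    obtain ⟨φ, hφ⟩ := FusionSystem.exists_continuousMonoidHom (P := ⟨P, hP⟩) (Q := .whole _)
      hcont hmul fun _ _ => trivial
    refine ⟨hP, φ, fun i => FusionSystem.isHomAlong_iff_exists_hom.1 ?_, hφ⟩
    simpa only [hφ] using h i

theorem limit_isHomAlong_iff {S : Type u} [Group S] [TopologicalSpace S] (b : S ≃ₜ* D.LimitGroup)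
    {P : Subgroup S} (hP : IsClosed (P : Set S)) {f : S → S} :
    D.limit.IsHomAlong (b : S →ₜ* D.LimitGroup) (fun x : P => b (f x)) ↔
      ∀ i, (D.sys i).IsHomAlong ((D.proj i).comp (b : S →ₜ* D.LimitGroup))
        fun x : P => D.proj i (b (f x)) := by
  have hbP : IsClosed (P.map (b : S →ₜ* D.LimitGroup).toMonoidHom : Set D.LimitGroup) :=
    b.toHomeomorph.isClosed_image.2 hP
  constructor
  · rintro ⟨g, hg, hgf⟩ i
    simpa only [hgf] using FusionSystem.isHomAlong_map_iff.1 ((D.limit_isHomOn_iff hbP).1 hg i)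
  · intro h
    have hbf (x : S) : b (f (b.symm ((b : S →ₜ* D.LimitGroup) x))) = b (f x) :=
      congrArg (fun y => b (f y)) (b.symm_apply_apply x)
    refine ⟨fun y => b (f (b.symm y)), (D.limit_isHomOn_iff hbP).2 fun i =>
      FusionSystem.isHomAlong_map_iff.2 ?_, fun x => hbf x⟩
    simpa only [hbf] using h i

end Limit

end FusionInverseSystem

namespace FusionSystem

theorem isHomAlong_id_iff {S : Type u} [Group S] [TopologicalSpace S] {F : FusionSystem S}
    {P : Subgroup S} {f : S → S} :
    F.IsHomAlong (.id S) (fun x : P => f x) ↔ F.IsHomOn f P := by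
  have hP : P.map (ContinuousMonoidHom.id S).toMonoidHom = P := P.map_id
  rw [IsHomAlong, hP]
  exact ⟨fun ⟨g, hg, hgf⟩ => hg.congr fun x hx => hgf ⟨x, hx⟩, fun hf => ⟨f, hf, fun _ => rfl⟩⟩

namespace Iso

section

variable {S : Type u} [Group S] [TopologicalSpace S] [CompactSpace S] [T2Space S]
  {T : Type v} [Group T] [TopologicalSpace T] [CompactSpace T] [T2Space T]
  {F : FusionSystem S} {G : FusionSystem T}

theorem isHomOn_iff (e : F.Iso G) {P : Subgroup S} {f : S → S} :
    F.IsHomOn f P ↔ G.IsHomAlong (e.toEquiv : S →ₜ* T) fun x : P => e.toEquiv (f x) := by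
  refine ⟨isMorphism_iff.1 e.isMorphism P f, fun h => isHomAlong_id_iff.1 ?_⟩
  have hid : (e.toEquiv.symm : T →ₜ* S).comp (e.toEquiv : S →ₜ* T) = .id S :=
    ContinuousMonoidHom.ext e.toEquiv.symm_apply_apply
  have hf := h.comp_isMorphism e.isMorphism_symm
  rw [hid] at hf
  exact (funext fun x : P => e.toEquiv.symm_apply_apply (f x)) ▸ hf

theorem exists_of_isHomOn_iff (b : S ≃ₜ* T) (h : ∀ (P : Subgroup S) (f : S → S),
      IsClosed (P : Set S) → (F.IsHomOn f P ↔ G.IsHomAlong (b : S →ₜ* T) fun x : P => b (f x))) :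
    ∃ e : F.Iso G, e.toEquiv = b := by
  refine ⟨⟨b, isMorphism_iff.2 fun P f hf => (h P f hf.isClosed).1 hf,
    isMorphism_iff.2 fun Q g hg => ?_⟩, rfl⟩
  have hbQ : IsClosed (Q.map (b.symm : T →ₜ* S).toMonoidHom : Set S) :=
    b.symm.toHomeomorph.isClosed_image.2 hg.isClosed
  refine ⟨fun x => b.symm (g (b x)), (h _ _ hbQ).2 (isHomAlong_map_iff.2 ?_), fun y =>
    congrArg (fun z => b.symm (g z)) (b.apply_symm_apply y)⟩
  have hid : (b : S →ₜ* T).comp (b.symm : T →ₜ* S) = .id T :=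
    ContinuousMonoidHom.ext b.apply_symm_apply
  rw [hid]
  have hbg (y : Q) : b (b.symm (g (b ((b.symm : T →ₜ* S) y)))) = g y :=
    (b.apply_symm_apply _).trans (congrArg g (b.apply_symm_apply y))
  simpa only [hbg] using isHomAlong_id_iff.2 hg

end

section Proj

variable {S : Type u} [Group S] [TopologicalSpace S] [CompactSpace S] [T2Space S]
  {F : FusionSystem S} {I : Type v} [PartialOrder I] {G : I → Type w}
  [∀ i, Group (G i)] [∀ i, TopologicalSpace (G i)] [∀ i, DiscreteTopology (G i)]
  [∀ i, Finite (G i)] {D : FusionInverseSystem I G} (e : F.Iso D.limit)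

/-- The projections `S → G i` of a group identified with an inverse limit. -/
def proj (i : I) : S →ₜ* G i :=
  (D.proj i).comp (e.toEquiv : S →ₜ* D.LimitGroup)

theorem map_proj {i j : I} (h : i ≤ j) (s : S) : D.map h (e.proj j s) = e.proj i s :=
  (e.toEquiv s).2 i j h

theorem map_comp_proj {i j : I} (h : i ≤ j) : (D.map h).comp (e.proj j) = e.proj i :=
  ContinuousMonoidHom.ext (e.map_proj h)

theorem proj_ext {s t : S} (h : ∀ i, e.proj i s = e.proj i t) : s = t :=
  e.toEquiv.injective (D.limit_ext h)

theorem exists_proj_eq {x : ∀ i, G i} (hx : ∀ i j (h : i ≤ j), D.map h (x j) = x i) :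
    ∃ s, ∀ i, e.proj i s = x i :=
  ⟨e.toEquiv.symm ⟨x, hx⟩, fun i => congrArg (D.proj i) (e.toEquiv.apply_symm_apply ⟨x, hx⟩)⟩

theorem isHomOn_iff_proj {P : Subgroup S} (hP : IsClosed (P : Set S)) {f : S → S} :
    F.IsHomOn f P ↔ ∀ i, (D.sys i).IsHomAlong (e.proj i) fun x : P => e.proj i (f x) :=
  e.isHomOn_iff.trans (D.limit_isHomAlong_iff e.toEquiv hP)

theorem isMorphism_proj (i : I) : F.IsMorphism (D.sys i) (e.proj i) :=
  isMorphism_iff.2 fun _ _ hf => (e.isHomOn_iff_proj hf.isClosed).1 hf i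

theorem exists_ker_proj_le [IsDirectedOrder I] [Nonempty I] {N : Subgroup S}
    (hN : IsOpen (N : Set S)) : ∃ k, (e.proj k).toMonoidHom.ker ≤ N := by
  have hclosed (i : I) : IsClosed ((e.proj i).toMonoidHom.ker : Set S) :=
    isClosed_singleton.preimage (e.proj i).continuous_toFun
  have hmono {i j : I} (h : i ≤ j) : (e.proj j).toMonoidHom.ker ≤ (e.proj i).toMonoidHom.ker :=
    fun s (hs : e.proj j s = 1) => show e.proj i s = 1 by rw [← e.map_proj h, hs, map_one]
  refine exists_subset_nhds_of_isCompact' (V := fun i => ((e.proj i).toMonoidHom.ker : Set S))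
    (fun i j => ?_) (fun i => (hclosed i).isCompact) hclosed fun x hx => ?_
  · obtain ⟨l, hil, hjl⟩ := exists_ge_ge i j
    exact ⟨l, hmono hil, hmono hjl⟩
  · obtain rfl : x = 1 :=
      e.proj_ext fun i => (Set.mem_iInter.1 hx i).trans (map_one (e.proj i)).symm
    exact hN.mem_nhds N.one_mem

theorem exists_isHomOn_of_compatible {P : Subgroup S} (hP : IsClosed (P : Set S))
    {a : ∀ i, P → G i} (ha : ∀ i, (D.sys i).IsHomAlong (e.proj i) (a i))
    (hcomp : ∀ i j (h : i ≤ j), D.map h ∘ a j = a i) :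
    ∃ f, F.IsHomOn f P ∧ ∀ i (x : P), e.proj i (f x) = a i x := by
  choose s hs using fun x : P => e.exists_proj_eq fun i j h => congrFun (hcomp i j h) x
  have hf (i : I) (x : P) : e.proj i (Function.extend Subtype.val s id x) = a i x := by
    rw [Subtype.val_injective.extend_apply, hs]
  refine ⟨_, (e.isHomOn_iff_proj hP).2 fun i => ?_, hf⟩
  simpa only [hf] using ha i

theorem exists_isHomOn_of_frequently [IsDirectedOrder I] {k : I} {P : Subgroup S}
    (hP : IsClosed (P : Set S)) {Θ : Set (P → G k)}
    (h : ∃ᶠ l in Filter.atTop, ∃ (hkl : k ≤ l) (a : P → G l),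
      (D.sys l).IsHomAlong (e.proj l) a ∧ D.map hkl ∘ a ∈ Θ) :
    ∃ f, F.IsHomOn f P ∧ (fun x : P => e.proj k (f x)) ∈ Θ := by
  let A (i : I) : Set (P → G i) :=
    {a | (D.sys i).IsHomAlong (e.proj i) a ∧ ∀ hki : k ≤ i, D.map hki ∘ a ∈ Θ}
  have : InverseSystem fun i j (h : i ≤ j) (a : P → G j) => D.map h ∘ a :=
    ⟨fun i a => funext fun x => D.map_self i (a x),
      fun i j l hij hjl a => funext fun x => D.map_map hij hjl (a x)⟩
  have hmap : ∀ i j (hij : i ≤ j), Set.MapsTo (D.map hij ∘ ·) (A j) (A i) := by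
    refine fun i j hij a ha =>
      ⟨e.map_comp_proj hij ▸ ha.1.comp_isMorphism (D.isMorphism hij), fun hki => ?_⟩
    simpa only [Function.comp_def, D.map_map] using ha.2 (hki.trans hij)
  have hne (i : I) : (A i).Nonempty := by
    have : Nonempty I := ⟨k⟩
    obtain ⟨l, hil, hkl, a, ha, haΘ⟩ := Filter.frequently_atTop.1 h i
    exact ⟨_, hmap i l hil ⟨ha, fun _ => haΘ⟩⟩
  obtain ⟨a, ha, hcomp⟩ := exists_compatible_of_finite _
    (fun i => ((D.sys i).finite_setOf_isHomAlong (e.proj i) P).subset fun a ha => ha.1) hne hmap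
  obtain ⟨f, hf, hfa⟩ := e.exists_isHomOn_of_compatible hP (fun i => (ha i).1) hcomp
  refine ⟨f, hf, ?_⟩
  simpa only [hfa, hcomp] using (ha k).2 le_rfl

end Proj

end Iso

theorem IsSaturated.isStronglyClosed_of_le {S : Type u} [Group S] [TopologicalSpace S]
    [DiscreteTopology S] [Finite S] {F : FusionSystem S} {p : ℕ} [Fact p.Prime]
    (hF : F.IsSaturated p) (hS : IsPGroup p S) {T N : Subgroup S} (hT : F.IsStronglyClosed T)
    (hTN : T ≤ N) (h : ∀ R g, F.IsHomOn g R → T ≤ R → R ≤ N → ∀ x ∈ R, g x ∈ N) :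
    F.IsStronglyClosed N := by
  refine isStronglyClosed_iff.2 fun P f hf hPN x hx => ?_
  obtain ⟨g, hg, hgf⟩ := hF.extendsModulo hS hT hf
  have hgx : g x ∈ N :=
    h _ g hg le_sup_right (sup_le hPN hTN) x (Subgroup.mem_sup_left hx)
  simpa using N.mul_mem hgx (hTN (QuotientGroup.eq.1 (hgf x hx)))

namespace Iso

section Extension

variable {S : Type u} [Group S] [TopologicalSpace S] [CompactSpace S] [T2Space S]
  {F : FusionSystem S} {I : Type v} [PartialOrder I] [IsDirectedOrder I] {G : I → Type w}
  [∀ i, Group (G i)] [∀ i, TopologicalSpace (G i)] [∀ i, DiscreteTopology (G i)]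
  [∀ i, Finite (G i)] {D : FusionInverseSystem I G} (e : F.Iso D.limit) {N P : Subgroup S} {k : I}

theorem eventually_map_mem (hN : F.IsStronglyClosed N) (hP : IsClosed (P : Set S)) (hPN : P ≤ N) :
    ∀ᶠ l in Filter.atTop, ∀ (hkl : k ≤ l) (a : P → G l), (D.sys l).IsHomAlong (e.proj l) a →
      ∀ x, D.map hkl (a x) ∈ N.map (e.proj k).toMonoidHom := by
  by_contra hfreq
  obtain ⟨f, hf, x, hfx⟩ := e.exists_isHomOn_of_frequently (k := k) hP
    (Θ := {b | ∃ x, b x ∉ N.map (e.proj k).toMonoidHom}) <| by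
      simpa only [Filter.not_eventually, not_forall, exists_prop] using! hfreq
  exact hfx ⟨f x, hN.map_mem hf hPN x.2, rfl⟩

variable {p : ℕ} [Fact p.Prime]

theorem eventually_isStronglyClosed (hp : ∀ i, IsPGroup p (G i))
    (hD : ∀ i, (D.sys i).IsSaturated p) (hN : F.IsStronglyClosed N)
    (hk : (e.proj k).toMonoidHom.ker ≤ N) :
    ∀ᶠ j in Filter.atTop, ∀ hkj : k ≤ j, (D.sys j).IsStronglyClosed
      ((N.map (e.proj k).toMonoidHom).comap (D.map hkj).toMonoidHom) := by
  have hfin := Filter.eventually_all.2 fun A : Set.Iic (N.map (e.proj k).toMonoidHom) =>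
    e.eventually_map_mem (P := A.1.comap (e.proj k).toMonoidHom) (k := k) hN
      ((isClosed_discrete _).preimage (e.proj k).continuous_toFun)
      ((Subgroup.comap_mono A.2).trans (Subgroup.comap_map_eq_self hk).le)
  filter_upwards [hfin] with j hj hkj
  have hker := (D.isMorphism hkj).isStronglyClosed_ker
  refine (hD j).isStronglyClosed_of_le (hp j) hker (MonoidHom.ker_le_comap _ _)
    fun R g hg hR hRN x hx => ?_
  have hPR : ((R.map (D.map hkj).toMonoidHom).comap (e.proj k).toMonoidHom).map
      (e.proj j).toMonoidHom ≤ R := by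
    rw [Subgroup.map_le_iff_le_comap, ← e.map_comp_proj hkj]
    exact Subgroup.comap_mono (f := (e.proj j).toMonoidHom) (Subgroup.comap_map_eq_self hR).le
  obtain ⟨s, -, hsx⟩ := hRN hx
  have hsP : s ∈ (R.map (D.map hkj).toMonoidHom).comap (e.proj k).toMonoidHom := ⟨x, hx, hsx.symm⟩
  have hgs : D.map hkj (g (e.proj j s)) ∈ N.map (e.proj k).toMonoidHom :=
    hj ⟨_, Subgroup.map_le_iff_le_comap.2 hRN⟩ hkj _
      ⟨g, hg.mono (isClosed_discrete _) hPR, fun _ => rfl⟩ ⟨s, hsP⟩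
  have hxs : (e.proj j s : G j ⧸ (D.map hkj).toMonoidHom.ker) = x :=
    QuotientGroup.eq.2 <| (MonoidHom.eq_iff _).1 <| ((e.map_proj hkj s).trans hsx).symm
  have hgxs : D.map hkj (g x) = D.map hkj (g (e.proj j s)) := (MonoidHom.eq_iff _).2 <|
    QuotientGroup.eq.1 (hg.map_congr hker (isClosed_discrete _) (hPR ⟨s, hsP, rfl⟩) hx hxs)
  change D.map hkj (g x) ∈ N.map (e.proj k).toMonoidHom
  rwa [hgxs]

include e in
theorem extendsModulo [IsTopologicalGroup S] (hp : ∀ i, IsPGroup p (G i))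
    (hD : ∀ i, (D.sys i).IsSaturated p) (hN : F.IsStronglyClosed N) (hNo : IsOpen (N : Set S))
    {f : S → S} (hf : F.IsHomOn f P) : F.ExtendsModulo N P f := by
  rcases isEmpty_or_nonempty I with hI | hI
  · exact hf.extendsModulo fun x _ => e.proj_ext (t := x) (fun i => hI.elim i) ▸ P.one_mem
  obtain ⟨k, hk⟩ := e.exists_ker_proj_le hNo
  have hPN : IsClosed ((P ⊔ N : Subgroup S) : Set S) :=
    Subgroup.isClosed_of_isOpen _ (Subgroup.isOpen_mono le_sup_right hNo)
  obtain ⟨g, hg, hgf⟩ := e.exists_isHomOn_of_frequently (k := k) hPN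
    (Θ := {b | ∀ u (hu : u ∈ P), (b ⟨u, Subgroup.mem_sup_left hu⟩)⁻¹ * e.proj k (f u) ∈
      N.map (e.proj k).toMonoidHom}) <| by
    refine Filter.Eventually.frequently ?_
    filter_upwards [e.eventually_isStronglyClosed hp hD hN hk, Filter.eventually_ge_atTop k]
      with l hl hkl
    obtain ⟨φ, hφ, hφf⟩ := (e.isHomOn_iff_proj hf.isClosed).1 hf l
    obtain ⟨ψ, hψ, hψφ⟩ := (hD l).extendsModulo (hp l) (hl hkl) hφ
    refine ⟨hkl, fun x => ψ (e.proj l x), ⟨ψ, hψ.mono (isClosed_discrete _) ?_, fun _ => rfl⟩,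
      fun u hu => ?_⟩
    · rw [Subgroup.map_sup, ← e.map_comp_proj hkl]
      refine sup_le_sup_left (Subgroup.map_le_iff_le_comap.2 ?_) _
      exact Subgroup.le_comap_map _ _
    · have h : D.map hkl ((ψ (e.proj l u))⁻¹ * φ (e.proj l u)) ∈ N.map (e.proj k).toMonoidHom :=
        QuotientGroup.eq.1 (hψφ _ ⟨u, hu, rfl⟩)
      rwa [hφf ⟨u, hu⟩, map_mul, map_inv, e.map_proj] at h
  refine ⟨g, hg, fun u hu => QuotientGroup.eq.2 ?_⟩
  rw [← Subgroup.comap_map_eq_self hk]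
  simpa using hgf u hu

end Extension

end Iso

section Quotient

variable {S : Type u} [Group S] [TopologicalSpace S] [IsTopologicalGroup S] [CompactSpace S]
  [T2Space S] {F : FusionSystem S} {p : ℕ} (hF : IsProFusion.{u, v, w} p F)

theorem quotient_isHomOn_iff (N : F.OSC) {A : Subgroup N.Quot} {g : N.Quot → N.Quot} :
    (F.quotient hF N).IsHomOn g A ↔ ∃ h, F.IsHomOn h (A.comap N.quotientMk.toMonoidHom) ∧
      ∀ u, N.quotientMk u ∈ A → g (N.quotientMk u) = N.quotientMk (h u) := by
  have hA : IsClosed (A : Set N.Quot) := isClosed_discrete _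
  constructor
  · rintro ⟨_, φ, ⟨ψ, hψ, hφψ⟩, hφg⟩
    obtain ⟨h, hh, hhψ⟩ := exists_isHomOn hψ
    refine ⟨h, hh, fun u hu => ?_⟩
    rw [hhψ ⟨u, hu⟩, ← hφψ ⟨u, hu⟩, hφg]
  · rintro ⟨h, hh, hgh⟩
    have hmul : ∀ x ∈ A, ∀ y ∈ A, g (x * y) = g x * g y := by
      refine N.quotientMk_surjective.forall.2 fun u hu =>
        N.quotientMk_surjective.forall.2 fun v hv => ?_
      rw [← map_mul, hgh _ (by rw [map_mul]; exact A.mul_mem hu hv), hgh u hu, hgh v hv,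
        hh.map_mul hu hv, map_mul]
    obtain ⟨φ, hφ⟩ := exists_continuousMonoidHom (P := ⟨A, hA⟩) (Q := .whole N.Quot)
      continuous_of_discreteTopology.continuousOn hmul fun _ _ => trivial
    obtain ⟨ψ, hψ, hψh⟩ := hh.exists_hom (P := (⟨A, hA⟩ : ClosedSubgroup N.Quot).preimage _)
      (Q := .whole S) fun _ _ => trivial
    refine ⟨hA, φ, ⟨ψ, hψ, fun u => ?_⟩, hφ⟩
    rw [hφ, hψh]
    exact hgh u u.2

theorem quotient_isHomAlong_iff (N : F.OSC) {P : Subgroup S} {f : S → S} :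
    (F.quotient hF N).IsHomAlong N.quotientMk (fun x : P => N.quotientMk (f x)) ↔
      F.ExtendsModulo N.toSubgroup P f := by
  have hcomap : (P.map N.quotientMk.toMonoidHom).comap N.quotientMk.toMonoidHom =
      P ⊔ N.toSubgroup := (QuotientGroup.comap_map_mk' N.toSubgroup P).trans (sup_comm _ _)
  constructor
  · rintro ⟨g, hg, hgf⟩
    obtain ⟨h, hh, hgh⟩ := (quotient_isHomOn_iff hF N).1 hg
    rw [hcomap] at hh
    exact ⟨h, hh, fun u hu => (hgh u ⟨u, hu, rfl⟩).symm.trans (hgf ⟨u, hu⟩)⟩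
  · rintro ⟨h, hh, hhf⟩
    have hout (u : S) (hu : N.quotientMk u ∈ P.map N.quotientMk.toMonoidHom) :
        N.quotientMk (h (N.quotientMk u).out) = N.quotientMk (h u) := by
      have hu' : N.quotientMk (N.quotientMk u).out = N.quotientMk u := QuotientGroup.out_eq' _
      exact hh.map_congr N.isStronglyClosed N.toOpenSubgroup.isClosed
        (hcomap.le (Subgroup.mem_comap.2 (hu'.symm ▸ hu))) (hcomap.le hu) hu'
    exact ⟨fun x => N.quotientMk (h x.out),
      (quotient_isHomOn_iff hF N).2 ⟨h, hcomap.symm ▸ hh, hout⟩,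
      fun x => (hout x ⟨x, x.2, rfl⟩).trans (hhf x x.2)⟩

theorem isMorphism_quotMap {M N : F.OSC} (hMN : M ≤ N)
    (hM : ∀ P f, F.IsHomOn f P → F.ExtendsModulo M.toSubgroup P f) :
    (F.quotient hF N).IsMorphism (F.quotient hF M) (OSC.quotMap hMN) := by
  refine isMorphism_iff.2 fun A g hg => ?_
  obtain ⟨h, hh, hgh⟩ := (quotient_isHomOn_iff hF N).1 hg
  obtain ⟨k, hk, hkh⟩ := (quotient_isHomAlong_iff hF M).2 (hM _ h hh)
  refine ⟨k, hk.mono (isClosed_discrete _) ?_, fun ⟨x, hx⟩ => ?_⟩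
  · rintro _ ⟨x, hx, rfl⟩
    obtain ⟨u, rfl⟩ := N.quotientMk_surjective x
    exact ⟨u, hx, rfl⟩
  · obtain ⟨u, rfl⟩ := N.quotientMk_surjective x
    exact (hkh ⟨u, hx⟩).trans (congrArg (OSC.quotMap hMN) (hgh u hx).symm)

omit [T2Space S] in
theorem OSC.exists_forall_quotientMk_eq {x : ∀ N : F.OSC, N.Quot}
    (hx : ∀ M N (hMN : M ≤ N), OSC.quotMap hMN (x N) = x M) :
    ∃ s, ∀ N : F.OSC, N.quotientMk s = x N := by
  have : Nonempty F.OSC := ⟨⟨⊤, fun _ _ _ _ _ => trivial⟩⟩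
  have hanti {M N : F.OSC} (hMN : M ≤ N) :
      {s | N.quotientMk s = x N} ⊆ {s | M.quotientMk s = x M} := fun s hs =>
    (congrArg (OSC.quotMap hMN) hs).trans (hx M N hMN)
  have hclosed (N : F.OSC) : IsClosed {s | N.quotientMk s = x N} :=
    isClosed_eq N.quotientMk.continuous_toFun continuous_const
  obtain ⟨s, hs⟩ := IsCompact.nonempty_iInter_of_directed_nonempty_isCompact_isClosed
    (fun N : F.OSC => {s | N.quotientMk s = x N})
    (fun M N => (exists_ge_ge M N).imp fun K hK => ⟨hanti hK.1, hanti hK.2⟩)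
    (fun N => N.quotientMk_surjective (x N)) (fun N => (hclosed N).isCompact) hclosed
  exact ⟨s, Set.mem_iInter.1 hs⟩

namespace Iso

variable {I : Type v} [PartialOrder I] {G : I → Type w} [∀ i, Group (G i)]
  [∀ i, TopologicalSpace (G i)] [∀ i, DiscreteTopology (G i)] [∀ i, Finite (G i)]
  {D : FusionInverseSystem I G} (e : F.Iso D.limit)

/-- The kernel of a projection `S → G i`, as an index of the inverse system of the `F / N`. -/
def kerProj (i : I) : F.OSC where
  toSubgroup := (e.proj i).toMonoidHom.ker
  isOpen' := (isOpen_discrete {(1 : G i)}).preimage (e.proj i).continuous_toFun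
  isStronglyClosed := (e.isMorphism_proj i).isStronglyClosed_ker

theorem quotientMk_kerProj_eq_iff {i : I} {s t : S} :
    (e.kerProj i).quotientMk s = (e.kerProj i).quotientMk t ↔ e.proj i s = e.proj i t :=
  eq_comm.trans (QuotientGroup.eq.trans (MonoidHom.eq_iff (e.proj i).toMonoidHom).symm)

end Iso

namespace IsProFusion

include hF

theorem isPGroup_quot (N : F.OSC) : IsPGroup p N.Quot := by
  obtain ⟨I, _, _, G, _, _, _, _, D, hp, ⟨e⟩⟩ := hF
  rcases isEmpty_or_nonempty I with hI | hI
  · have : Subsingleton S := ⟨fun s t => e.proj_ext fun i => hI.elim i⟩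
    exact fun x => ⟨0, Subsingleton.elim _ _⟩
  · obtain ⟨k, hk⟩ := e.exists_ker_proj_le N.isOpen'
    refine N.quotientMk_surjective.forall.2 fun s => ?_
    obtain ⟨n, hn⟩ := hp k (e.proj k s)
    exact ⟨n, (QuotientGroup.eq_one_iff _).2 (hk ((map_pow (e.proj k) s _).trans hn))⟩

theorem eq_of_forall_quotientMk_eq {s t : S} (h : ∀ N : F.OSC, N.quotientMk s = N.quotientMk t) :
    s = t := by
  obtain ⟨I, _, _, G, _, _, _, _, D, -, ⟨e⟩⟩ := hF
  exact e.proj_ext fun i => e.quotientMk_kerProj_eq_iff.1 (h (e.kerProj i))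

theorem isHomOn_of_forall_extendsModulo {P : Subgroup S} (hP : IsClosed (P : Set S)) {f : S → S}
    (h : ∀ N : F.OSC, F.ExtendsModulo N.toSubgroup P f) : F.IsHomOn f P := by
  obtain ⟨I, _, _, G, _, _, _, _, D, -, ⟨e⟩⟩ := hF
  refine (e.isHomOn_iff_proj hP).2 fun i => ?_
  obtain ⟨g, hg, hgf⟩ := h (e.kerProj i)
  obtain ⟨φ, hφ, hφg⟩ := isMorphism_iff.1 (e.isMorphism_proj i) _ g hg
  refine ⟨φ, hφ.mono (isClosed_discrete _) (Subgroup.map_mono le_sup_left), fun x => ?_⟩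
  exact (hφg ⟨x, Subgroup.mem_sup_left x.2⟩).trans (e.quotientMk_kerProj_eq_iff.1 (hgf x x.2))

theorem exists_continuousMulEquiv_quotientLimit (h : ∀ (M N : F.OSC) (hMN : M ≤ N),
      (F.quotient hF N).IsMorphism (F.quotient hF M) (OSC.quotMap hMN)) :
    ∃ b : S ≃ₜ* (F.quotientSystem hF h).LimitGroup,
      ∀ N s, (F.quotientSystem hF h).proj N (b s) = N.quotientMk s := by
  let b (s : S) : (F.quotientSystem hF h).LimitGroup := ⟨fun N => N.quotientMk s, fun _ _ _ => rfl⟩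
  have hcont : Continuous b :=
    (continuous_pi fun N => N.quotientMk.continuous_toFun).subtype_mk _
  have hinj : Function.Injective b := fun s t hst =>
    hF.eq_of_forall_quotientMk_eq fun N => congrFun (congrArg Subtype.val hst) N
  have hsurj : Function.Surjective b := fun x => by
    obtain ⟨s, hs⟩ := OSC.exists_forall_quotientMk_eq fun M N hMN => x.2 M N hMN
    exact ⟨s, Subtype.ext (funext hs)⟩
  exact ⟨.mk' (hcont.homeoOfEquivCompactToT2 (f := .ofBijective b ⟨hinj, hsurj⟩))
    fun _ _ => rfl, fun _ _ => rfl⟩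

end IsProFusion

theorem IsProSaturated.extendsModulo [Fact p.Prime] (hF : IsProSaturated.{u, v, w} p F) (N : F.OSC)
    {P : Subgroup S} {f : S → S} (hf : F.IsHomOn f P) : F.ExtendsModulo N.toSubgroup P f := by
  obtain ⟨I, _, _, G, _, _, _, _, D, hp, hD, ⟨e⟩⟩ := hF
  exact e.extendsModulo hp hD N.isStronglyClosed N.isOpen' hf

end Quotient

end FusionSystem

theorem mainTheorem4 (p : ℕ) [Fact p.Prime] {S : Type u} [Group S] [TopologicalSpace S]
    [IsTopologicalGroup S] [CompactSpace S] [T2Space S] (F : FusionSystem S)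
    (hF : FusionSystem.IsProSaturated.{u, v, w} p F) :
    (∀ N : F.OSC, IsPGroup p N.Quot) ∧
    ∃ h : ∀ (M N : F.OSC) (hMN : M ≤ N),
        (F.quotient hF.isProFusion N).IsMorphism (F.quotient hF.isProFusion M)
          (FusionSystem.OSC.quotMap hMN),
      ∃ e : F.Iso (F.quotientSystem hF.isProFusion h).limit,
        ∀ (N : F.OSC) (s : S),
          (F.quotientSystem hF.isProFusion h).proj N (e.toEquiv s) = N.quotientMk s := by
  have h : ∀ (M N : F.OSC) (hMN : M ≤ N), (F.quotient hF.isProFusion N).IsMorphism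
      (F.quotient hF.isProFusion M) (FusionSystem.OSC.quotMap hMN) := fun M N hMN =>
    FusionSystem.isMorphism_quotMap _ hMN fun P f hf => hF.extendsModulo M hf
  obtain ⟨b, hb⟩ := hF.isProFusion.exists_continuousMulEquiv_quotientLimit h
  have hmk (N : F.OSC) : ((F.quotientSystem hF.isProFusion h).proj N).comp
      (b : S →ₜ* (F.quotientSystem hF.isProFusion h).LimitGroup) = N.quotientMk :=
    ContinuousMonoidHom.ext (hb N)
  obtain ⟨e, rfl⟩ := FusionSystem.Iso.exists_of_isHomOn_iff
      (G := (F.quotientSystem hF.isProFusion h).limit) b fun P f hP =>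
    calc F.IsHomOn f P
      _ ↔ ∀ N : F.OSC, F.ExtendsModulo N.toSubgroup P f :=
        ⟨fun hf N => hF.extendsModulo N hf, hF.isProFusion.isHomOn_of_forall_extendsModulo hP⟩
      _ ↔ ∀ N : F.OSC, (F.quotient hF.isProFusion N).IsHomAlong N.quotientMk
            fun x : P => N.quotientMk (f x) :=
        forall_congr' fun N => (FusionSystem.quotient_isHomAlong_iff _ N).symm
      _ ↔ _ := by
        rw [FusionInverseSystem.limit_isHomAlong_iff _ b hP]
        simp only [hmk, hb]
        rfl
  exact ⟨hF.isProFusion.isPGroup_quot, h, e, hb⟩
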